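/- Let $\mathcal X$ be a finite set and, for every $N\ge 1$, let $\pi^N$ be a probability distribution on $\mathcal X^N$. Let $$D(\pi^N)=\frac1N\sum_{i=1}^N\mathbb E_{x\sim\pi^N}\Big[\log\frac{\pi^N(x)}{\pi^N(x_i)\,\pi^N(x_{-i})}\Big],\qquad x_{-i}=(x_j)_{j\ne i},$$ and let the information profile of $\pi^N$ be $$f^N(i)=\mathbb E_{x\sim\pi^N,\ \sigma\sim\mathrm{Unif}}\big[\log\pi^N(x_{\sigma_{i+1}}\mid x_{\sigma_1},\dots,x_{\sigma_i})\big],\qquad 0\le i\le N-1,$$ where $\sigma$ is a uniformly random permutation of $\{1,\dots,N\}$ independent of $x$. Put $\Delta f^N(i)=f^N(i)-f^N(i-1)$, and define $g^N$ on $[0,1-\tfrac1N)$ by $$g^N(u)=\frac{N}{D(\pi^N)}\,\Delta f^N(i)\quad\text{for } u\in\Big[\frac{i-1}{N},\frac iN\Big),\quad i=1,\dots,N-1$$ (with $g^N=0$ in the degenerate case $D(\pi^N)=0$). For integers $0=a_0\le a_1\le\dots\le a_K=N$ let $$A^N(\mathbf a)=\sum_{i=0}^{N-1}f^N(i)-\sum_{k=0}^{K-1}(a_{k+1}-a_k)f^N(a_k),$$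 where terms with $a_{k+1}=a_k$ are zero. (This is the factorization error of the sampler that unmasks the coordinates in uniformly random order with schedule $\mathbf a$.) Let $\alpha:[0,1]\to[0,1]$ be nondecreasing and of class $C^1$ with $\alpha_0=0$, $\alpha_1=1$, and let $a^{N,K}_k=\lceil N\alpha_{k/K}\rceil$ for $0\le k\le K$. Assume that $g^N$ converges uniformly to a continuous function $g:[0,1]\to[0,\infty)$, that is, $\sup_{u\in[0,1-1/N)}|g^N(u)-g(u)|\to0$ as $N\to\infty$. Assume that $\dot\alpha$ has finitely many minimum and maximum points, plateaus being allowed, in the sense that $[0,1]$ can be cut at finitely many points into intervals on each of which $\dot\alpha$ is monotone. For $\bar s\in[1,\infty)$ and $u\ge0$ let $$h_{\bar s}(u)=\frac1{\bar s^2}\big(1-\{\bar su\}\big)\lfloor\bar su\rfloor^2+\frac1{\bar s^2}\{\bar su\}\lceil\bar su\rceil^2,\qquad \{v\}=v-\lfloor v\rfloor,$$ the continuous function equal to $u^2$ at the points $u=n/\bar s$, $n\in\mathbb N$, and affine in between. Then, as $N,K\to\infty$ with $N/K\to\bar s\in[1,\infty)$, $$A^N(\mathbf a^{N,K})=\frac{D(\pi^N)}2\Big(\bar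 s\int_0^1g(\alpha_t)\,h_{\bar s}(\dot\alpha_t)\,dt-1+o(1)\Big).$$ -/

import Mathlib

open Filter Topology Set

noncomputable section

namespace MaskedDiffusion

variable {X : Type*} [Fintype X] {N : ℕ}

open Classical in
/-- The marginal probability `π(x_S)`: the `π`-probability that a sequence agrees with `x` at all
the positions in `S`. -/
def marginal (π : PMF (Fin N → X)) (S : Finset (Fin N)) (x : Fin N → X) : ℝ :=
  ∑ y : Fin N → X, if ∀ i ∈ S, y i = x i then (π y).toReal else 0

/-- The conditional probability `π(x_j | x_S)` for `j ∉ S`. -/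
def condProb (π : PMF (Fin N → X)) (S : Finset (Fin N)) (j : Fin N) (x : Fin N → X) : ℝ :=
  marginal π (insert j S) x / marginal π S x

/-- The expectation of `φ(x)` for `x ∼ π`. -/
def expect (π : PMF (Fin N → X)) (φ : (Fin N → X) → ℝ) : ℝ :=
  ∑ x : Fin N → X, (π x).toReal * φ x

/-- `D(π) = (1/N) ∑ i, E_π [log (π(x) / (π(x_i) π(x_{-i})))]`. -/
def corr (π : PMF (Fin N → X)) : ℝ :=
  (1 / (N : ℝ)) * ∑ i : Fin N, expect π fun x =>
    Real.log ((π x).toReal / (marginal π {i} x * marginal π (Finset.univ.erase i) x))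

/-- The information profile
`f(i) = E_{x ∼ π, σ ∼ Unif} [log π(x_{σ_{i+1}} | x_{σ_1}, …, x_{σ_i})]` for `0 ≤ i ≤ N - 1`.
Positions are numbered from `0`, so `σ_{i+1}` is `σ ⟨i, _⟩` and `{σ_1, …, σ_i}` is the image under
`σ` of the positions below `i`. The value is `0` for `i ≥ N`. -/
def infoProfile (π : PMF (Fin N → X)) (i : ℕ) : ℝ :=
  if h : i < N then
    (1 / (N.factorial : ℝ)) * ∑ σ : Equiv.Perm (Fin N), expect π fun x =>
      Real.log (condProb π ((Finset.univ.filter fun j : Fin N => (j : ℕ) < i).image σ) (σ ⟨i, h⟩) x)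
  else 0

/-- The discrete derivative `Δf(i) = f(i) - f(i-1)`, used for `1 ≤ i ≤ N - 1`. -/
def deltaProfile (π : PMF (Fin N → X)) (i : ℕ) : ℝ :=
  infoProfile π i - infoProfile π (i - 1)

/-- The random-order factorization error of a deterministic schedule `a_0, …, a_K`:
`A(a) = ∑_{i=0}^{N-1} f(i) - ∑_{k=0}^{K-1} (a_{k+1} - a_k) f(a_k)`. -/
def factError (π : PMF (Fin N → X)) (K : ℕ) (a : ℕ → ℕ) : ℝ :=
  ∑ i ∈ Finset.range N, infoProfile π i
    - ∑ k ∈ Finset.range K, ((a (k + 1) : ℝ) - (a k : ℝ)) * infoProfile π (a k)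

/-- The rescaled derivative of the information profile: `g^N(u) = (N / D(π)) Δf(i)` for
`u ∈ [(i-1)/N, i/N)`, that is `i = ⌊N u⌋ + 1`; used for `u ∈ [0, 1 - 1/N)`. -/
def rescaledProfile (π : PMF (Fin N → X)) (u : ℝ) : ℝ :=
  (N : ℝ) / corr π * deltaProfile π (⌊(N : ℝ) * u⌋₊ + 1)

/-- The schedule `a_k = ⌈N α(k/K)⌉` for `0 ≤ k ≤ K`. -/
def schedule (α : ℝ → ℝ) (N K k : ℕ) : ℕ := ⌈(N : ℝ) * α ((k : ℝ) / (K : ℝ))⌉₊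

/-- `h_s(u)`: the function equal to `u²` at the points `u = n/s`, `n ∈ ℕ`, and affine in between. -/
def quantSq (s u : ℝ) : ℝ :=
  1 / s ^ 2 * (1 - Int.fract (s * u)) * (⌊s * u⌋ : ℝ) ^ 2
    + 1 / s ^ 2 * Int.fract (s * u) * (⌈s * u⌉ : ℝ) ^ 2

/-- `φ` has finitely many changes of monotonicity on `[0,1]`: up to a finite set of points, `[0,1]`
splits into intervals on which `φ` is monotone. This is the form of "`φ` has finitely many minimum
and maximum points" in which plateaus are allowed (a constant `φ` qualifies); see
`IsPiecewiseMonotone.of_finite_extrema` for the comparison with local extrema. -/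
def IsPiecewiseMonotone (φ : ℝ → ℝ) : Prop :=
  ∃ S : Finset ℝ, ∀ a b : ℝ, 0 ≤ a → a < b → b ≤ 1 → (∀ s ∈ S, s ∉ Ioo a b) →
    MonotoneOn φ (Icc a b) ∨ AntitoneOn φ (Icc a b)

/-- A continuous function on `[0,1]` with finitely many local extremum points, not counting those
near which it is constant, is piecewise monotone. -/
theorem IsPiecewiseMonotone.of_finite_extrema {φ : ℝ → ℝ} (hφ : ContinuousOn φ (Icc 0 1))
    (hfin : {t ∈ Icc (0 : ℝ) 1 | IsLocalExtrOn φ (Icc 0 1) t ∧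
      ¬ ∀ᶠ s in 𝓝[Icc 0 1] t, φ s = φ t}.Finite) : IsPiecewiseMonotone φ := by
  have key : ∀ ψ : ℝ → ℝ, ContinuousOn ψ (Icc 0 1) → ∀ x y z : ℝ, 0 ≤ x → x < y → y < z → z ≤ 1 →
      ψ x < ψ y → ψ z < ψ y → ∃ c ∈ Ioo x z, IsLocalMaxOn ψ (Icc 0 1) c ∧
        ¬ ∀ᶠ s in 𝓝[Icc 0 1] c, ψ s = ψ c := by
    intro ψ hψ x y z hx hxy hyz hz h1 h2
    have hsub : Icc x z ⊆ Icc (0 : ℝ) 1 := Icc_subset_Icc hx hz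
    obtain ⟨m, hm, hmax⟩ := isCompact_Icc.exists_isMaxOn ⟨y, hxy.le, hyz.le⟩ (hψ.mono hsub)
    have hcl : IsCompact (Icc x z ∩ ψ ⁻¹' {ψ m}) :=
      isCompact_Icc.of_isClosed_subset
        ((hψ.mono hsub).preimage_isClosed_of_isClosed isClosed_Icc isClosed_singleton)
        inter_subset_left
    obtain ⟨c, ⟨hc, hcm⟩, hleast⟩ := hcl.exists_isLeast ⟨m, hm, rfl⟩
    have hcm' : ψ c = ψ m := hcm
    have hy : ψ y ≤ ψ c := hcm' ▸ hmax ⟨hxy.le, hyz.le⟩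
    have hxc : x < c := lt_of_le_of_ne hc.1 (by rintro rfl; linarith)
    have hcz : c < z := lt_of_le_of_ne hc.2 (by rintro rfl; linarith)
    refine ⟨c, ⟨hxc, hcz⟩, ?_, ?_⟩
    · refine mem_nhdsWithin_of_mem_nhds (mem_of_superset (Icc_mem_nhds hxc hcz) ?_)
      intro s hs
      exact hcm' ▸ hmax hs
    · intro hev
      have hle : 𝓝[Ioo x c] c ≤ 𝓝[Icc 0 1] c :=
        nhdsWithin_mono _ fun s hs => hsub ⟨hs.1.le, hs.2.le.trans hcz.le⟩
      have hne : (𝓝[Ioo x c] c).NeBot := by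
        rw [← mem_closure_iff_nhdsWithin_neBot, closure_Ioo hxc.ne]
        exact ⟨hxc.le, le_rfl⟩
      obtain ⟨s, hs1, hs2⟩ := ((hev.filter_mono hle).and self_mem_nhdsWithin).exists
      have := hleast ⟨⟨hs2.1.le, hs2.2.le.trans hcz.le⟩, hs1.trans hcm'⟩
      linarith [hs2.2]
  refine ⟨hfin.toFinset, fun a b ha hab hb hS => ?_⟩
  by_contra hcon
  rw [not_or] at hcon
  obtain ⟨x, hx, y, hy, z, hz, hxy, hyz, h⟩ :=
    not_monotoneOn_not_antitoneOn_iff_exists_lt_lt.1 hcon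
  rcases h with ⟨h1, h2⟩ | ⟨h1, h2⟩
  · obtain ⟨c, hc, hm, hn⟩ := key φ hφ x y z (ha.trans hx.1) hxy hyz (hz.2.trans hb) h1 h2
    refine hS c ?_ ⟨hx.1.trans_lt hc.1, hc.2.trans_le hz.2⟩
    rw [Set.Finite.mem_toFinset]
    exact ⟨⟨by linarith [hx.1, hc.1], by linarith [hz.2, hc.2]⟩, Or.inr hm, hn⟩
  · obtain ⟨c, hc, hm, hn⟩ := key (fun s => - φ s) hφ.neg x y z (ha.trans hx.1) hxy hyz
      (hz.2.trans hb) (by simpa using h1) (by simpa using h2)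
    refine hS c ?_ ⟨hx.1.trans_lt hc.1, hc.2.trans_le hz.2⟩
    rw [Set.Finite.mem_toFinset]
    refine ⟨⟨by linarith [hx.1, hc.1], by linarith [hz.2, hc.2]⟩, Or.inl ?_, ?_⟩
    · filter_upwards [hm] with s hs
      simpa using hs
    · simpa using hn

end MaskedDiffusion

end

/-! Telescoping `infoProfile` inside each step writes the error as a sum over steps of triangular
double sums of `deltaProfile` (`factError_eq_sum`). Steps have bounded length, so on step k the
rescaled derivative is nearly the constant g(α(k/K)), and a step of length n contributes about
D/(2N) · g(α(k/K)) · n(n-1).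

The linear part (1/N) Σ g n tends to 1, because the increments of the profile add up to exactly D
(`corr_eq_infoProfile_sub`).

For the quadratic part, let x = N(α((k+1)/K) - α(k/K)) be the unrounded step. Taking ceilings makes
n one of ⌊x⌋, ⌊x⌋+1, and n - x is a difference of consecutive rounding errors θ in [0,1). Hence n² =
`interpSq` x + (2⌊x⌋+1)(θ_{k+1} - θ_k) exactly (`schedule_sub_sq`), which is where the piecewise
affine h comes from. The second term is not small termwise, but it cancels under summation by parts
once the weights g(α)(2⌊x⌋+1) have total variation o(N) (`tendsto_weighted_rounding_sum`). Piecewise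
monotonicity of α' passes to x by the mean value theorem, so ⌊x⌋ has variation bounded independently
of N and K (`exists_bound_variation_floor_increment`). The first term is a Riemann sum, since x ≈ s
α' (`tendsto_weighted_interpSq_sum`).

If D = 0, strong subadditivity makes the profile monotone, hence constant, and both sides vanish. -/

namespace MaskedDiffusion

/-! ### Entropy inequalities and the information profile. -/

section Probability

/-- The indicator of agreement on `S`. -/
noncomputable def agree {X : Type*} {N : ℕ} (S : Finset (Fin N)) (x y : Fin N → X) : ℝ :=
  open Classical in if ∀ i ∈ S, x i = y i then 1 else 0

theorem agree_nonneg {X : Type*} {N : ℕ} (S : Finset (Fin N)) (x y : Fin N → X) :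
    0 ≤ agree S x y := by
  unfold agree; split_ifs <;> norm_num

theorem agree_comm {X : Type*} {N : ℕ} (S : Finset (Fin N)) (x y : Fin N → X) :
    agree S x y = agree S y x := by
  classical
  unfold agree
  congr 1
  exact propext (forall₂_congr fun i _ => eq_comm)

variable {X : Type*} [Fintype X] {N : ℕ}

theorem sum_toReal_eq_one {Ω : Type*} [Fintype Ω] (μ : PMF Ω) : ∑ x, (μ x).toReal = 1 := by
  rw [← ENNReal.toReal_sum fun x _ => μ.apply_ne_top x, ← tsum_fintype (L := .unconditional _),
    μ.tsum_coe, ENNReal.toReal_one]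

open Classical in
theorem marginal_congr (π : PMF (Fin N → X)) {S : Finset (Fin N)} {x y : Fin N → X}
    (h : ∀ i ∈ S, x i = y i) : marginal π S x = marginal π S y := by
  refine Finset.sum_congr rfl fun z _ => if_congr ?_ rfl rfl
  exact forall₂_congr fun i hi => by rw [h i hi]

open Classical in
theorem marginal_nonneg (π : PMF (Fin N → X)) (S : Finset (Fin N)) (x : Fin N → X) :
    0 ≤ marginal π S x :=
  Finset.sum_nonneg fun y _ => by split_ifs <;> simp

open Classical in
theorem marginal_pos (π : PMF (Fin N → X)) (S : Finset (Fin N)) {x : Fin N → X}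
    (hx : (π x).toReal ≠ 0) : 0 < marginal π S x := by
  have h0 : 0 < (π x).toReal := lt_of_le_of_ne ENNReal.toReal_nonneg hx.symm
  refine h0.trans_le ?_
  have := Finset.single_le_sum (s := Finset.univ)
    (f := fun y : Fin N → X => if ∀ i ∈ S, y i = x i then (π y).toReal else 0)
    (fun y _ => by split_ifs <;> simp) (Finset.mem_univ x)
  simpa [marginal] using this

open Classical in
theorem marginal_univ (π : PMF (Fin N → X)) (x : Fin N → X) :
    marginal π Finset.univ x = (π x).toReal := by
  simp [marginal, ← funext_iff]

open Classical in
theorem marginal_empty (π : PMF (Fin N → X)) (x : Fin N → X) : marginal π ∅ x = 1 := by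
  simpa [marginal] using sum_toReal_eq_one π

theorem expect_congr (π : PMF (Fin N → X)) {φ ψ : (Fin N → X) → ℝ}
    (h : ∀ x, (π x).toReal ≠ 0 → φ x = ψ x) : expect π φ = expect π ψ := by
  refine Finset.sum_congr rfl fun x _ => ?_
  by_cases hx : (π x).toReal = 0
  · simp [hx]
  · rw [h x hx]

theorem expect_sub (π : PMF (Fin N → X)) (φ ψ : (Fin N → X) → ℝ) :
    expect π (fun x => φ x - ψ x) = expect π φ - expect π ψ := by
  simp [expect, mul_sub, Finset.sum_sub_distrib]

theorem expect_log_condProb (π : PMF (Fin N → X)) (S : Finset (Fin N)) (j : Fin N) :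
    expect π (fun x => Real.log (condProb π S j x))
      = expect π (fun x => Real.log (marginal π (insert j S) x))
        - expect π (fun x => Real.log (marginal π S x)) := by
  rw [← expect_sub]
  refine expect_congr π fun x hx => ?_
  rw [condProb, Real.log_div (marginal_pos π _ hx).ne' (marginal_pos π _ hx).ne']

theorem marginal_eq_sum_agree (π : PMF (Fin N → X)) (S : Finset (Fin N)) (x : Fin N → X) :
    marginal π S x = ∑ y, (π y).toReal * agree S y x := by
  simp [marginal, agree]

theorem sum_agree (S : Finset (Fin N)) (y : Fin N → X) :
    ∑ x, agree S x y = ∏ i, if i ∈ S then 1 else (Fintype.card X : ℝ) := by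
  classical
  have : (Finset.univ.filter fun x : Fin N → X => ∀ i ∈ S, x i = y i)
      = Fintype.piFinset fun i => if i ∈ S then {y i} else Finset.univ := by
    ext x
    simp only [Finset.mem_filter, Finset.mem_univ, true_and, Fintype.mem_piFinset]
    refine forall_congr' fun i => ?_
    by_cases h : i ∈ S <;> simp [h]
  calc ∑ x, agree S x y = ((Finset.univ.filter fun x : Fin N → X => ∀ i ∈ S, x i = y i).card : ℝ) := by
        simp [agree]
    _ = _ := by
        rw [this, Fintype.card_piFinset]
        push_cast
        refine Finset.prod_congr rfl fun i _ => ?_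
        by_cases h : i ∈ S <;> simp [h]

/-- A point x contributes only if y and z agree on A ∩ B; it is then prescribed on A ∪ B by gluing y
and z, and free elsewhere. -/
theorem sum_agree_mul_agree_le (A B : Finset (Fin N)) (y z : Fin N → X) :
    ∑ x, agree A x y * agree B x z
      ≤ agree (A ∩ B) y z * ∏ i, if i ∈ A ∪ B then 1 else (Fintype.card X : ℝ) := by
  classical
  by_cases h : ∀ i ∈ A ∩ B, y i = z i
  · rw [agree, if_pos h, one_mul, ← sum_agree _ (fun i => if i ∈ A then y i else z i)]
    refine Finset.sum_le_sum fun x _ => ?_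
    by_cases h1 : ∀ i ∈ A, x i = y i
    · by_cases h2 : ∀ i ∈ B, x i = z i
      · have : ∀ i ∈ A ∪ B, x i = if i ∈ A then y i else z i := by
          intro i hi
          split_ifs with hA
          · exact h1 i hA
          · exact h2 i ((Finset.mem_union.1 hi).resolve_left hA)
        rw [agree, agree, agree, if_pos h1, if_pos h2, if_pos this, one_mul]
      · rw [agree, agree, if_neg h2, mul_zero]
        exact agree_nonneg _ _ _
    · rw [agree, if_neg h1, zero_mul]
      exact agree_nonneg _ _ _
  · rw [agree, if_neg h, zero_mul]
    refine Finset.sum_nonpos fun x _ => ?_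
    by_cases h1 : ∀ i ∈ A, x i = y i
    · have h2 : ¬ ∀ i ∈ B, x i = z i := fun h2 => h fun i hi => by
        rw [Finset.mem_inter] at hi
        rw [← h1 i hi.1, h2 i hi.2]
      simp [agree, h2]
    · simp [agree, h1]

/-- The ratio depends only on the coordinates in A ∪ B. Summing over all of X^N instead of X^(A ∪ B)
multiplies by the constant c, the number of completions. After cancelling the joint marginal, what
remains is the total mass of p(x_A) p(x_B) / p(x_{A ∩ B}), which is at most 1. -/
theorem expect_marginal_ratio_le_one (π : PMF (Fin N → X)) (A B : Finset (Fin N)) :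
    expect π (fun x => marginal π A x * marginal π B x
      / (marginal π (A ∪ B) x * marginal π (A ∩ B) x)) ≤ 1 := by
  classical
  set c : ℝ := ∏ i : Fin N, if i ∈ A ∪ B then 1 else (Fintype.card X : ℝ) with hc
  obtain ⟨x₀, -⟩ := π.support_nonempty
  have hcpos : 0 < c := by
    refine Finset.prod_pos fun i _ => ?_
    have : 0 < Fintype.card X := Fintype.card_pos_iff.2 ⟨x₀ i⟩
    split_ifs
    · norm_num
    · exact_mod_cast this
  refine le_of_mul_le_mul_left ?_ hcpos
  rw [mul_one]
  set R : (Fin N → X) → ℝ := fun x => marginal π A x * marginal π B x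
      / (marginal π (A ∪ B) x * marginal π (A ∩ B) x) with hR
  have hRc : ∀ x y : Fin N → X, agree (A ∪ B) x y * R x = agree (A ∪ B) x y * R y := by
    intro x y
    by_cases h : ∀ i ∈ A ∪ B, x i = y i
    · have hA : marginal π A x = marginal π A y :=
        marginal_congr π fun i hi => h i (Finset.mem_union_left _ hi)
      have hB : marginal π B x = marginal π B y :=
        marginal_congr π fun i hi => h i (Finset.mem_union_right _ hi)
      have hI : marginal π (A ∩ B) x = marginal π (A ∩ B) y :=
        marginal_congr π fun i hi => h i (Finset.mem_union_left _ (Finset.mem_inter.1 hi).1)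
      simp only [hR, hA, hB, hI, marginal_congr π h]
    · rw [agree, if_neg h, zero_mul, zero_mul]
  calc c * expect π R = ∑ y, (π y).toReal * ∑ x, agree (A ∪ B) x y * R y := by
        simp only [expect, Finset.mul_sum, ← Finset.sum_mul, sum_agree, ← hc]
        exact Finset.sum_congr rfl fun y _ => by ring
    _ = ∑ x, marginal π (A ∪ B) x * R x := by
        simp only [Finset.mul_sum]
        rw [Finset.sum_comm]
        refine Finset.sum_congr rfl fun x _ => ?_
        rw [marginal_eq_sum_agree, Finset.sum_mul]
        exact Finset.sum_congr rfl fun y _ => by rw [← hRc x y, agree_comm _ x y]; ring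
    -- Equality holds wherever the marginal on A ∪ B is nonzero; elsewhere the left term is 0 by the
    -- convention for division by zero.
    _ ≤ ∑ x, marginal π A x * (marginal π B x / marginal π (A ∩ B) x) := by
        refine Finset.sum_le_sum fun x _ => ?_
        have h1 := marginal_nonneg π A x
        have h2 := marginal_nonneg π B x
        have h3 := marginal_nonneg π (A ∩ B) x
        rcases (marginal_nonneg π (A ∪ B) x).eq_or_lt with h | h
        · rw [← h, zero_mul]; positivity
        · simp only [hR]
          apply le_of_eq
          rw [← mul_div_assoc, mul_div_mul_left _ _ h.ne', mul_div_assoc]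
    _ = ∑ y, (π y).toReal * ∑ x, agree A y x * (marginal π B x / marginal π (A ∩ B) y) := by
        simp only [Finset.mul_sum]
        rw [Finset.sum_comm]
        refine Finset.sum_congr rfl fun x _ => ?_
        rw [marginal_eq_sum_agree π A, Finset.sum_mul]
        refine Finset.sum_congr rfl fun y _ => ?_
        by_cases h : ∀ i ∈ A, y i = x i
        · rw [marginal_congr π (S := A ∩ B) fun i hi => h i (Finset.mem_inter.1 hi).1]
          ring
        · simp [agree, h]
    _ ≤ ∑ y, (π y).toReal * c := by
        refine Finset.sum_le_sum fun y _ => ?_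
        rcases eq_or_ne (π y).toReal 0 with h | h
        · rw [h, zero_mul, zero_mul]
        refine mul_le_mul_of_nonneg_left ?_ ENNReal.toReal_nonneg
        have hI := marginal_pos π (A ∩ B) h
        simp only [← mul_div_assoc]
        rw [← Finset.sum_div, div_le_iff₀ hI]
        calc ∑ x, agree A y x * marginal π B x
            = ∑ z, (π z).toReal * ∑ x, agree A x y * agree B x z := by
              simp only [marginal_eq_sum_agree, Finset.mul_sum]
              rw [Finset.sum_comm]
              refine Finset.sum_congr rfl fun z _ => Finset.sum_congr rfl fun x _ => ?_
              rw [agree_comm A, agree_comm B]; ring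
          _ ≤ ∑ z, (π z).toReal * (agree (A ∩ B) y z * c) :=
              Finset.sum_le_sum fun z _ => mul_le_mul_of_nonneg_left
                (sum_agree_mul_agree_le A B y z) ENNReal.toReal_nonneg
          _ = c * marginal π (A ∩ B) y := by
              rw [marginal_eq_sum_agree, Finset.mul_sum]
              exact Finset.sum_congr rfl fun z _ => by rw [agree_comm]; ring
    _ = c := by rw [← Finset.sum_mul, sum_toReal_eq_one, one_mul]

/-- Strong subadditivity of the Shannon entropy. -/
theorem expect_log_marginal_supermodular (π : PMF (Fin N → X)) (A B : Finset (Fin N)) :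
    expect π (fun x => Real.log (marginal π A x)) + expect π (fun x => Real.log (marginal π B x))
      ≤ expect π (fun x => Real.log (marginal π (A ∪ B) x))
        + expect π (fun x => Real.log (marginal π (A ∩ B) x)) := by
  classical
  have h1 : expect π (fun x => Real.log (marginal π A x))
      + expect π (fun x => Real.log (marginal π B x))
      - expect π (fun x => Real.log (marginal π (A ∪ B) x))
      - expect π (fun x => Real.log (marginal π (A ∩ B) x))
      ≤ expect π (fun x => marginal π A x * marginal π B x
      / (marginal π (A ∪ B) x * marginal π (A ∩ B) x)) - ∑ x, (π x).toReal := by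
    simp only [expect, ← Finset.sum_add_distrib, ← Finset.sum_sub_distrib]
    refine Finset.sum_le_sum fun x _ => ?_
    rcases eq_or_ne (π x).toReal 0 with h | h
    · simp [h]
    have hA := marginal_pos π A h
    have hB := marginal_pos π B h
    have hU := marginal_pos π (A ∪ B) h
    have hI := marginal_pos π (A ∩ B) h
    -- log t ≤ t - 1 at the ratio whose expectation is at most 1.
    have := Real.log_le_sub_one_of_pos (div_pos (mul_pos hA hB) (mul_pos hU hI))
    rw [Real.log_div (by positivity) (by positivity), Real.log_mul hA.ne' hB.ne',
      Real.log_mul hU.ne' hI.ne'] at this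
    have := mul_le_mul_of_nonneg_left this (ENNReal.toReal_nonneg (a := π x))
    linarith
  rw [sum_toReal_eq_one] at h1
  linarith [expect_marginal_ratio_le_one π A B]

theorem infoProfile_le_succ (π : PMF (Fin N → X)) {i : ℕ} (hi : i + 1 < N) :
    infoProfile π i ≤ infoProfile π (i + 1) := by
  classical
  have hi' : i < N := by omega
  rw [infoProfile, infoProfile, dif_pos hi, dif_pos hi']
  refine mul_le_mul_of_nonneg_left ?_ (by positivity)
  set p : Fin N := ⟨i, hi'⟩
  set q : Fin N := ⟨i + 1, hi⟩
  have hpq : p ≠ q := by simp [p, q, Fin.ext_iff]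
  -- Swapping positions i and i+1 on the left makes both sides reveal the same coordinate σ q, given
  -- S on the left and S ∪ {σ p} on the right. Supermodularity then compares them for each σ.
  rw [← Equiv.sum_comp (Equiv.mulRight (Equiv.swap p q))]
  refine Finset.sum_le_sum fun σ _ => ?_
  have himg : (Finset.univ.filter fun j : Fin N => (j : ℕ) < i).image (σ * Equiv.swap p q)
      = (Finset.univ.filter fun j : Fin N => (j : ℕ) < i).image σ := by
    refine Finset.image_congr fun j hj => ?_
    simp only [Finset.coe_filter, Finset.mem_univ, true_and, mem_ofPred_eq] at hj
    rw [Equiv.Perm.mul_apply, Equiv.swap_apply_of_ne_of_ne]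
    · rintro rfl; simp [p] at hj
    · rintro rfl; simp [q] at hj
  have hfil : (Finset.univ.filter fun j : Fin N => (j : ℕ) < i + 1)
      = insert p (Finset.univ.filter fun j : Fin N => (j : ℕ) < i) := by
    ext j
    simp only [Finset.mem_filter, Finset.mem_univ, true_and, Finset.mem_insert, p, Fin.ext_iff]
    omega
  have hval : (σ * Equiv.swap p q) p = σ q := by simp
  simp only [Equiv.coe_mulRight]
  rw [himg, hval, hfil, Finset.image_insert, expect_log_condProb, expect_log_condProb]
  set S := (Finset.univ.filter fun j : Fin N => (j : ℕ) < i).image σ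
  have hI : insert (σ q) S ∩ insert (σ p) S = S := by
    ext j
    simp only [Finset.mem_inter, Finset.mem_insert]
    constructor
    · rintro ⟨rfl | h, h' | h'⟩
      · exact absurd (σ.injective h') hpq.symm
      all_goals assumption
    · exact fun h => ⟨Or.inr h, Or.inr h⟩
  have hU : insert (σ q) S ∪ insert (σ p) S = insert (σ q) (insert (σ p) S) := by
    ext j
    simp only [Finset.mem_union, Finset.mem_insert]
    tauto
  have := expect_log_marginal_supermodular π (insert (σ q) S) (insert (σ p) S)
  rw [hI, hU] at this
  linarith

theorem average_perm_apply (F : Fin N → ℝ) (a : Fin N) :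
    1 / (N.factorial : ℝ) * ∑ σ : Equiv.Perm (Fin N), F (σ a) = 1 / (N : ℝ) * ∑ i, F i := by
  have hN : (N : ℝ) ≠ 0 := by
    have := a.pos
    positivity
  have hconst : ∀ b : Fin N, ∑ σ : Equiv.Perm (Fin N), F (σ b)
      = ∑ σ : Equiv.Perm (Fin N), F (σ a) := by
    intro b
    rw [← Equiv.sum_comp (Equiv.mulRight (Equiv.swap a b))]
    simp
  have h : (N : ℝ) * ∑ σ : Equiv.Perm (Fin N), F (σ a) = N.factorial * ∑ i, F i := by
    calc (N : ℝ) * ∑ σ : Equiv.Perm (Fin N), F (σ a)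
        = ∑ b : Fin N, ∑ σ : Equiv.Perm (Fin N), F (σ b) := by simp [hconst]
      _ = ∑ σ : Equiv.Perm (Fin N), ∑ i, F i := by
        rw [Finset.sum_comm]
        exact Finset.sum_congr rfl fun σ _ => Equiv.sum_comp σ F
      _ = N.factorial * ∑ i, F i := by simp [Fintype.card_perm]
  have hf : (N.factorial : ℝ) ≠ 0 := by positivity
  field_simp
  linarith

/-- The logarithm in `corr` is log π(x_i | x_{-i}) - log π(x_i). Averaged over i, these are the last
and first values of the profile, since σ sends a fixed position to a uniform one. -/
theorem corr_eq_infoProfile_sub (π : PMF (Fin N → X)) (hN : 0 < N) :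
    corr π = infoProfile π (N - 1) - infoProfile π 0 := by
  classical
  have hl : N - 1 < N := by omega
  have h0 : infoProfile π 0
      = 1 / (N : ℝ) * ∑ i, expect π fun x => Real.log (marginal π {i} x) := by
    rw [infoProfile, dif_pos hN,
      ← average_perm_apply (fun i => expect π fun x => Real.log (marginal π {i} x)) ⟨0, hN⟩]
    simp [condProb, marginal_empty]
  have h1 : infoProfile π (N - 1) = 1 / (N : ℝ) * ∑ i, expect π fun x =>
      Real.log (condProb π (Finset.univ.erase i) i x) := by
    rw [infoProfile, dif_pos hl, ← average_perm_apply (fun i => expect π fun x =>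
      Real.log (condProb π (Finset.univ.erase i) i x)) ⟨N - 1, hl⟩]
    congr 1
    refine Finset.sum_congr rfl fun σ _ => ?_
    have : (Finset.univ.filter fun j : Fin N => (j : ℕ) < N - 1).image σ
        = Finset.univ.erase (σ ⟨N - 1, hl⟩) := by
      have h : (Finset.univ.filter fun j : Fin N => (j : ℕ) < N - 1)
          = Finset.univ.erase ⟨N - 1, hl⟩ := by
        ext j
        simp only [Finset.mem_filter, Finset.mem_univ, true_and, Finset.mem_erase, ne_eq,
          Fin.ext_iff, and_true]
        omega
      rw [h, Finset.image_erase σ.injective, Finset.image_univ_of_surjective σ.surjective]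
    rw [this]
  rw [h0, h1, ← mul_sub, ← Finset.sum_sub_distrib, corr]
  congr 1
  refine Finset.sum_congr rfl fun i _ => ?_
  rw [← expect_sub]
  refine expect_congr π fun x hx => ?_
  have hA := marginal_pos π {i} hx
  have hB := marginal_pos π (Finset.univ.erase i) hx
  rw [condProb, Finset.insert_erase (Finset.mem_univ i), marginal_univ, Real.log_div hx hB.ne',
    Real.log_div hx (by positivity), Real.log_mul hA.ne' hB.ne']
  ring

theorem infoProfile_mono (π : PMF (Fin N → X)) {i j : ℕ} (hij : i ≤ j) (hj : j < N) :
    infoProfile π i ≤ infoProfile π j := by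
  induction j, hij using Nat.le_induction with
  | base => exact le_rfl
  | succ n hn ih => exact (ih (by omega)).trans (infoProfile_le_succ π hj)

/-- Without correlation, the information profile is constant. -/
theorem infoProfile_eq_of_corr_eq_zero (π : PMF (Fin N → X)) (h : corr π = 0) {i : ℕ}
    (hi : i < N) : infoProfile π i = infoProfile π 0 := by
  rw [corr_eq_infoProfile_sub π (by omega)] at h
  have h1 := infoProfile_mono π (Nat.zero_le i) hi
  have h2 := infoProfile_mono π (show i ≤ N - 1 by omega) (by omega)
  linarith

theorem sum_range_eq_sum_sum_Ico (F : ℕ → ℝ) {a : ℕ → ℕ} {K : ℕ} (h0 : a 0 = 0)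
    (ha : ∀ k < K, a k ≤ a (k + 1)) :
    ∑ i ∈ Finset.range (a K), F i
      = ∑ k ∈ Finset.range K, ∑ i ∈ Finset.Ico (a k) (a (k + 1)), F i := by
  induction K with
  | zero => simp [h0]
  | succ K ih =>
    rw [Finset.sum_range_succ, ← ih fun k hk => ha k (by omega), Finset.range_eq_Ico,
      Finset.range_eq_Ico, Finset.sum_Ico_consecutive _ (Nat.zero_le _) (ha K (by omega))]

theorem factError_eq_sum (π : PMF (Fin N → X)) {a : ℕ → ℕ} {K : ℕ} (h0 : a 0 = 0)
    (ha : ∀ k < K, a k ≤ a (k + 1)) (hK : a K = N) :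
    factError π K a = ∑ k ∈ Finset.range K, ∑ i ∈ Finset.Ico (a k) (a (k + 1)),
      ∑ j ∈ Finset.Ico (a k) i, deltaProfile π (j + 1) := by
  have h := sum_range_eq_sum_sum_Ico (infoProfile π) h0 ha
  rw [hK] at h
  rw [factError, h, ← Finset.sum_sub_distrib]
  refine Finset.sum_congr rfl fun k hk => ?_
  have hk' := ha k (Finset.mem_range.1 hk)
  calc _ = ∑ i ∈ Finset.Ico (a k) (a (k + 1)), (infoProfile π i - infoProfile π (a k)) := by
        rw [Finset.sum_sub_distrib, Finset.sum_const, Nat.card_Ico, nsmul_eq_mul,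
          Nat.cast_sub hk']
    _ = _ := by
        refine Finset.sum_congr rfl fun i hi => ?_
        rw [← Finset.sum_Ico_sub _ (Finset.mem_Ico.1 hi).1]
        simp [deltaProfile]

theorem factError_eq_zero_of_corr_eq_zero (π : PMF (Fin N → X)) (h : corr π = 0)
    {a : ℕ → ℕ} {K : ℕ} (h0 : a 0 = 0) (ha : ∀ k < K, a k ≤ a (k + 1)) (hK : a K = N) :
    factError π K a = 0 := by
  rw [factError_eq_sum π h0 ha hK]
  have hle : ∀ n ≤ K, ∀ k ≤ n, a k ≤ a n := by
    intro n
    induction n with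
    | zero => intro _ k hk; rw [Nat.le_zero.1 hk]
    | succ n ih =>
      intro hn k hk
      rcases Nat.lt_or_ge k (n + 1) with h | h
      · exact (ih (by omega) k (by omega)).trans (ha n (by omega))
      · rw [le_antisymm hk h]
  refine Finset.sum_eq_zero fun k hk => Finset.sum_eq_zero fun i hi =>
    Finset.sum_eq_zero fun j hj => ?_
  have hk' := hle K le_rfl (k + 1) (Finset.mem_range.1 hk)
  rw [Finset.mem_Ico] at hi hj
  rw [deltaProfile, Nat.add_sub_cancel, infoProfile_eq_of_corr_eq_zero π h (i := j + 1) (by omega),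
    infoProfile_eq_of_corr_eq_zero π h (i := j) (by omega), sub_self]

theorem sum_deltaProfile (π : PMF (Fin N → X)) (hN : 0 < N) :
    ∑ j ∈ Finset.range (N - 1), deltaProfile π (j + 1) = corr π := by
  rw [corr_eq_infoProfile_sub π hN, ← Finset.sum_range_sub]
  simp [deltaProfile]

theorem rescaledProfile_div (π : PMF (Fin N → X)) (hN : 0 < N) (j : ℕ) :
    rescaledProfile π ((j : ℝ) / N) = (N : ℝ) / corr π * deltaProfile π (j + 1) := by
  have : (N : ℝ) ≠ 0 := by positivity
  rw [rescaledProfile, mul_div_cancel₀ _ this, Nat.floor_natCast]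

end Probability

/-! ### The piecewise affine interpolation of the square. -/

section Interpolation

/-- The piecewise affine function equal to `n²` at the integers `n`. -/
noncomputable def interpSq (x : ℝ) : ℝ :=
  (2 * (⌊x⌋ : ℝ) + 1) * x - ⌊x⌋ * (⌊x⌋ + 1)

theorem quantSq_eq_interpSq (s u : ℝ) : quantSq s u = interpSq (s * u) / s ^ 2 := by
  have h : (1 - Int.fract (s * u)) * (⌊s * u⌋ : ℝ) ^ 2 + Int.fract (s * u) * (⌈s * u⌉ : ℝ) ^ 2
      = interpSq (s * u) := by
    rcases eq_or_ne (Int.fract (s * u)) 0 with h | h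
    · have : s * u = ⌊s * u⌋ := by linarith [Int.floor_add_fract (s * u)]
      rw [h, interpSq]
      linear_combination (-(2 * (⌊s * u⌋ : ℝ)) - 1) * this
    · have h1 : (⌈s * u⌉ : ℝ) = ⌊s * u⌋ + 1 := by
        have := Int.ceil_eq_add_one_sub_fract h
        linarith [Int.floor_add_fract (s * u)]
      rw [h1, interpSq, ← Int.self_sub_floor]
      ring
  rw [quantSq, ← h]
  ring

/-- By convexity `interpSq` is the maximum of its chords, so Lipschitz bounds need no case split
over integers between two points. -/
theorem affine_le_interpSq (n : ℤ) (x : ℝ) : (2 * (n : ℝ) + 1) * x - n * (n + 1) ≤ interpSq x := by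
  have h1 := Int.floor_le x
  have h2 := Int.lt_floor_add_one x
  unfold interpSq
  rcases lt_trichotomy n ⌊x⌋ with h | h | h
  · have h' : (n : ℝ) + 1 ≤ ⌊x⌋ := by exact_mod_cast h
    nlinarith
  · rw [h]
  · have h' : (⌊x⌋ : ℝ) + 1 ≤ n := by exact_mod_cast h
    nlinarith

theorem abs_interpSq_sub_le {M x y : ℝ} (hx : x ∈ Icc 0 M) (hy : y ∈ Icc 0 M) :
    |interpSq x - interpSq y| ≤ (2 * M + 1) * |x - y| := by
  have key : ∀ x ∈ Icc 0 M, ∀ y, interpSq x - interpSq y ≤ (2 * M + 1) * |x - y| := by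
    intro x hx y
    have h := affine_le_interpSq ⌊x⌋ y
    have h0 : (0 : ℝ) ≤ ⌊x⌋ := by exact_mod_cast Int.floor_nonneg.2 hx.1
    have h1 : (⌊x⌋ : ℝ) ≤ M := (Int.floor_le x).trans hx.2
    calc interpSq x - interpSq y ≤ (2 * (⌊x⌋ : ℝ) + 1) * (x - y) := by
          unfold interpSq at *; linarith
      _ ≤ (2 * (⌊x⌋ : ℝ) + 1) * |x - y| := by gcongr; exact le_abs_self _
      _ ≤ _ := by gcongr
  refine abs_le.2 ⟨?_, key x hx y⟩
  have := key y hy x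
  rw [abs_sub_comm] at this
  linarith

theorem continuousOn_interpSq (M : ℝ) : ContinuousOn interpSq (Icc 0 M) := by
  rcases lt_or_ge M 0 with h | h
  · simp [Icc_eq_empty_of_lt h]
  · refine LipschitzOnWith.continuousOn (K := ⟨2 * M + 1, by positivity⟩) ?_
    refine LipschitzOnWith.of_dist_le_mul fun x hx y hy => ?_
    rw [Real.dist_eq, Real.dist_eq]
    exact abs_interpSq_sub_le hx hy

theorem interpSq_mem_Icc {M x : ℝ} (hx : x ∈ Icc 0 M) : interpSq x ∈ Icc 0 ((2 * M + 1) * M) := by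
  have h0 : interpSq 0 = 0 := by simp [interpSq]
  have h := abs_interpSq_sub_le hx ⟨le_rfl, hx.1.trans hx.2⟩
  have hM := hx.1.trans hx.2
  rw [h0, sub_zero, sub_zero, abs_of_nonneg hx.1] at h
  refine ⟨?_, (le_abs_self _).trans (h.trans (by gcongr; exact hx.2))⟩
  have := affine_le_interpSq 0 x
  push_cast at this
  linarith [hx.1]

/-- Both candidates for n are ends of the chord active at x, so the discrepancy is the chord's slope
times n - x. -/
theorem sq_sub_interpSq {n : ℤ} {x : ℝ} (h1 : ⌊x⌋ ≤ n) (h2 : n ≤ ⌊x⌋ + 1) :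
    (n : ℝ) ^ 2 - interpSq x = (2 * (⌊x⌋ : ℝ) + 1) * (n - x) := by
  unfold interpSq
  obtain rfl | rfl : n = ⌊x⌋ ∨ n = ⌊x⌋ + 1 := by omega
  · ring
  · push_cast; ring

end Interpolation

/-! ### Summation by parts and total variation. -/

section Variation

theorem sum_mul_sub_eq (w θ : ℕ → ℝ) (n : ℕ) :
    ∑ k ∈ Finset.range (n + 1), w k * (θ (k + 1) - θ k)
      = w n * θ (n + 1) - w 0 * θ 0 - ∑ k ∈ Finset.range n, (w (k + 1) - w k) * θ (k + 1) := by
  induction n with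
  | zero => simp; ring
  | succ n ih => rw [Finset.sum_range_succ, ih, Finset.sum_range_succ _ n]; ring

/-- Summation by parts against a sequence with values in `[0,1]` vanishing at the ends. -/
theorem abs_sum_mul_sub_le (w θ : ℕ → ℝ) (n : ℕ) (h0 : θ 0 = 0) (hn : θ (n + 1) = 0)
    (hθ : ∀ k ≤ n, |θ k| ≤ 1) :
    |∑ k ∈ Finset.range (n + 1), w k * (θ (k + 1) - θ k)|
      ≤ ∑ k ∈ Finset.range n, |w (k + 1) - w k| := by
  rw [sum_mul_sub_eq, h0, hn, mul_zero, mul_zero, sub_zero, zero_sub, abs_neg]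
  refine (Finset.abs_sum_le_sum_abs _ _).trans (Finset.sum_le_sum fun k hk => ?_)
  rw [abs_mul]
  exact mul_le_of_le_one_right (abs_nonneg _) (hθ _ (by simpa using hk))

/-- A bounded sequence which is monotone on every run of indices avoiding a finite set `B` has
variation controlled by the size of `B`. -/
theorem sum_abs_sub_le_of_piecewise_monotone {y : ℕ → ℝ} {M : ℝ} {B : Finset ℕ} {n : ℕ}
    (hy : ∀ k ≤ n, y k ∈ Icc 0 M)
    (hB : ∀ a b, a < b → b ≤ n → (∀ k ∈ Finset.Ico a b, k ∉ B) →
      MonotoneOn y (Icc a b) ∨ AntitoneOn y (Icc a b)) :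
    ∑ k ∈ Finset.range n, |y (k + 1) - y k| ≤ M * (2 * B.card + 1) := by
  have hdiff : ∀ i ≤ n, ∀ j ≤ n, |y i - y j| ≤ M := fun i hi j hj => by
    have h1 := hy i hi
    have h2 := hy j hj
    rw [abs_le]
    constructor <;> linarith [h1.1, h1.2, h2.1, h2.2]
  have hM : 0 ≤ M := (hy 0 (Nat.zero_le _)).1.trans (hy 0 (Nat.zero_le _)).2
  -- Each k in B met by the range costs one jump k → k+1 and splits it into two ranges with fewer
  -- such points: M(2c₁+1) + M + M(2c₂+1) = M(2(c₁+c₂+1)+1).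
  have key : ∀ c a b, a ≤ b → b ≤ n → (B ∩ Finset.Ico a b).card ≤ c →
      ∑ k ∈ Finset.Ico a b, |y (k + 1) - y k| ≤ M * (2 * (B ∩ Finset.Ico a b).card + 1) := by
    intro c
    induction c using Nat.strong_induction_on with
    | _ c ih =>
    intro a b hab hb hc
    rcases (B ∩ Finset.Ico a b).eq_empty_or_nonempty with he | ⟨k, hk⟩
    · rw [he, Finset.card_empty, Nat.cast_zero, mul_zero, zero_add, mul_one]
      rcases hab.eq_or_lt with rfl | hlt
      · simpa using hM
      rcases hB a b hlt hb fun k hk hkB =>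
        Finset.notMem_empty k (he ▸ Finset.mem_inter.2 ⟨hkB, hk⟩) with h | h
      · calc ∑ k ∈ Finset.Ico a b, |y (k + 1) - y k|
            = ∑ k ∈ Finset.Ico a b, (y (k + 1) - y k) := by
              refine Finset.sum_congr rfl fun k hk => abs_of_nonneg (sub_nonneg.2 ?_)
              rw [Finset.mem_Ico] at hk
              exact h ⟨hk.1, hk.2.le⟩ ⟨by omega, hk.2⟩ (Nat.le_succ k)
          _ = y b - y a := Finset.sum_Ico_sub _ hab
          _ ≤ M := (le_abs_self _).trans (hdiff _ hb _ (hab.trans hb))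
      · calc ∑ k ∈ Finset.Ico a b, |y (k + 1) - y k|
            = ∑ k ∈ Finset.Ico a b, -(y (k + 1) - y k) := by
              refine Finset.sum_congr rfl fun k hk => abs_of_nonpos (sub_nonpos.2 ?_)
              rw [Finset.mem_Ico] at hk
              exact h ⟨hk.1, hk.2.le⟩ ⟨by omega, hk.2⟩ (Nat.le_succ k)
          _ = -(y b - y a) := by rw [Finset.sum_neg_distrib, Finset.sum_Ico_sub _ hab]
          _ ≤ M := (neg_le_abs _).trans (hdiff _ hb _ (hab.trans hb))
    · have hkB := (Finset.mem_inter.1 hk).1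
      have hkI := Finset.mem_Ico.1 (Finset.mem_inter.1 hk).2
      have hsplit : (B ∩ Finset.Ico a b).card
          = (B ∩ Finset.Ico a k).card + (B ∩ Finset.Ico (k + 1) b).card + 1 := by
        have h1 : B ∩ Finset.Ico a b
            = insert k ((B ∩ Finset.Ico a k) ∪ (B ∩ Finset.Ico (k + 1) b)) := by
          ext j
          simp only [Finset.mem_inter, Finset.mem_Ico, Finset.mem_insert, Finset.mem_union]
          constructor
          · rintro ⟨hj, h1, h2⟩
            rcases lt_trichotomy j k with h | h | h
            · exact Or.inr (Or.inl ⟨hj, h1, h⟩)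
            · exact Or.inl h
            · exact Or.inr (Or.inr ⟨hj, h, h2⟩)
          · rintro (rfl | ⟨hj, h1, h2⟩ | ⟨hj, h1, h2⟩)
            · exact ⟨hkB, hkI⟩
            · exact ⟨hj, h1, by omega⟩
            · exact ⟨hj, by omega, h2⟩
        rw [h1, Finset.card_insert_of_notMem (by simp), Finset.card_union_of_disjoint]
        refine Finset.disjoint_left.2 fun j h1 h2 => ?_
        simp only [Finset.mem_inter, Finset.mem_Ico] at h1 h2
        omega
      have hA := ih (B ∩ Finset.Ico a k).card (by omega) a k hkI.1 (by omega) le_rfl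
      have hC := ih (B ∩ Finset.Ico (k + 1) b).card (by omega) (k + 1) b (by omega) hb le_rfl
      have hk1 := hdiff (k + 1) (by omega) k (by omega)
      rw [← Finset.sum_Ico_consecutive _ hkI.1 hkI.2.le, Finset.sum_eq_sum_Ico_succ_bot hkI.2,
        hsplit]
      push_cast
      linarith
  have h := key _ 0 n (Nat.zero_le n) le_rfl le_rfl
  rw [← Finset.range_eq_Ico] at h
  refine h.trans ?_
  gcongr
  exact Finset.inter_subset_left

/-- The indices `k` for which `(k/K, (k+2)/K)` meets a finite set `S` are at most `2 |S|`. -/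
theorem exists_finset_of_cells (S : Finset ℝ) {K : ℕ} (hK : 0 < K) :
    ∃ B : Finset ℕ, B.card ≤ 2 * S.card ∧
      ∀ k : ℕ, ∀ t ∈ S, t ∈ Ioo ((k : ℝ) / K) (((k + 2 : ℕ) : ℝ) / K) → k ∈ B := by
  classical
  -- k/K < t < (k+2)/K forces ⌈Kt⌉ to be k+1 or k+2. Two cells are needed because the jump from
  -- increment k to increment k+1 sees both.
  refine ⟨S.image (fun t => ⌈(K : ℝ) * t⌉₊ - 1) ∪ S.image (fun t => ⌈(K : ℝ) * t⌉₊ - 2), ?_, ?_⟩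
  · refine (Finset.card_union_le _ _).trans ?_
    have h1 := Finset.card_image_le (s := S) (f := fun t => ⌈(K : ℝ) * t⌉₊ - 1)
    have h2 := Finset.card_image_le (s := S) (f := fun t => ⌈(K : ℝ) * t⌉₊ - 2)
    omega
  · intro k t ht ⟨h1, h2⟩
    have hK' : (0 : ℝ) < K := by exact_mod_cast hK
    rw [div_lt_iff₀ hK', mul_comm] at h1
    rw [lt_div_iff₀ hK', mul_comm] at h2
    have h3 : k < ⌈(K : ℝ) * t⌉₊ := Nat.lt_ceil.2 h1
    have h4 : ⌈(K : ℝ) * t⌉₊ ≤ k + 2 := Nat.ceil_le.2 h2.le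
    rw [Finset.mem_union, Finset.mem_image, Finset.mem_image]
    by_cases h : ⌈(K : ℝ) * t⌉₊ = k + 1
    · exact Or.inl ⟨t, ht, by omega⟩
    · exact Or.inr ⟨t, ht, by omega⟩

end Variation

/-! ### Increments of the unrounded schedule. -/

section Curve

variable {α : ℝ → ℝ}

theorem div_mem_Icc_zero_one {k K : ℕ} (h : k ≤ K) : (k : ℝ) / K ∈ Icc (0 : ℝ) 1 :=
  ⟨by positivity, div_le_one_of_le₀ (by exact_mod_cast h) (by positivity)⟩

theorem div_lt_div_succ {k K : ℕ} (hk : k < K) : (k : ℝ) / K < ((k + 1 : ℕ) : ℝ) / K := by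
  have : (0 : ℝ) < K := by exact_mod_cast (Nat.zero_le k).trans_lt hk
  gcongr
  omega

/-- Mean value theorem on the cell `[k/K, (k+1)/K]`. -/
theorem exists_derivWithin_eq (hα : ContDiffOn ℝ 1 α (Icc 0 1)) {K k : ℕ} (hk : k < K) :
    ∃ ξ ∈ Ioo ((k : ℝ) / K) (((k + 1 : ℕ) : ℝ) / K),
      α (((k + 1 : ℕ) : ℝ) / K) - α ((k : ℝ) / K) = derivWithin α (Icc 0 1) ξ / K := by
  have h0 := div_mem_Icc_zero_one hk.le
  have h1 := div_mem_Icc_zero_one (show k + 1 ≤ K from hk)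
  have hlt := div_lt_div_succ hk
  have hsub : Icc ((k : ℝ) / K) (((k + 1 : ℕ) : ℝ) / K) ⊆ Icc 0 1 := Icc_subset_Icc h0.1 h1.2
  obtain ⟨ξ, hξ, h⟩ := exists_hasDerivAt_eq_slope α (derivWithin α (Icc 0 1)) hlt
    (hα.continuousOn.mono hsub) fun x hx => by
      have hx' : x ∈ Icc (0 : ℝ) 1 := hsub ⟨hx.1.le, hx.2.le⟩
      exact ((hα.differentiableOn one_ne_zero) x hx').hasDerivWithinAt.hasDerivAt
        (Icc_mem_nhds (h0.1.trans_lt hx.1) (hx.2.trans_le h1.2))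
  refine ⟨ξ, hξ, ?_⟩
  have hK : (0 : ℝ) < K := by exact_mod_cast (Nat.zero_le k).trans_lt hk
  have hd : ((k + 1 : ℕ) : ℝ) / K - (k : ℝ) / K = 1 / K := by push_cast; ring
  rw [h, hd]
  field_simp

/-- The increment of the unrounded schedule. -/
noncomputable def increment (α : ℝ → ℝ) (N K k : ℕ) : ℝ :=
  N * (α (((k + 1 : ℕ) : ℝ) / K) - α ((k : ℝ) / K))

theorem exists_increment_eq (hα : ContDiffOn ℝ 1 α (Icc 0 1)) (N : ℕ) {K k : ℕ} (hk : k < K) :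
    ∃ ξ ∈ Ioo ((k : ℝ) / K) (((k + 1 : ℕ) : ℝ) / K),
      increment α N K k = N / K * derivWithin α (Icc 0 1) ξ := by
  obtain ⟨ξ, hξ, h⟩ := exists_derivWithin_eq hα hk
  exact ⟨ξ, hξ, by rw [increment, h]; ring⟩

theorem increment_mem_Icc (hα : ContDiffOn ℝ 1 α (Icc 0 1)) (hmono : MonotoneOn α (Icc 0 1))
    {L r : ℝ} (hL : ∀ t ∈ Icc (0 : ℝ) 1, derivWithin α (Icc 0 1) t ≤ L) {N K k : ℕ}
    (hr : (N : ℝ) / K ≤ r) (hk : k < K) : increment α N K k ∈ Icc 0 (r * L) := by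
  obtain ⟨ξ, hξ, h⟩ := exists_increment_eq hα N hk
  have hξ' : ξ ∈ Icc (0 : ℝ) 1 := ⟨(div_mem_Icc_zero_one hk.le).1.trans hξ.1.le,
    hξ.2.le.trans (div_mem_Icc_zero_one (show k + 1 ≤ K from hk)).2⟩
  have h0 : 0 ≤ derivWithin α (Icc 0 1) ξ := hmono.derivWithin_nonneg
  have h1 : (0 : ℝ) ≤ (N : ℝ) / K := by positivity
  rw [h]
  exact ⟨mul_nonneg h1 h0, mul_le_mul hr (hL ξ hξ') h0 (h1.trans hr)⟩

/-- Mean value points of distinct cells are ordered like the cells, so monotonicity of the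
derivative passes to the increments. -/
theorem increment_monotoneOn (hα : ContDiffOn ℝ 1 α (Icc 0 1)) (N : ℕ) {K a b : ℕ} (hb : b < K)
    (h : MonotoneOn (derivWithin α (Icc 0 1)) (Icc ((a : ℝ) / K) (((b + 1 : ℕ) : ℝ) / K))) :
    MonotoneOn (increment α N K) (Icc a b) := by
  intro i hi j hj hij
  rcases hij.eq_or_lt with rfl | hlt
  · exact le_rfl
  obtain ⟨ξ, hξ, h1⟩ := exists_increment_eq hα N (hi.2.trans_lt hb)
  obtain ⟨η, hη, h2⟩ := exists_increment_eq hα N (hj.2.trans_lt hb)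
  rw [h1, h2]
  have e1 : (a : ℝ) / K ≤ (i : ℝ) / K := by have := hi.1; gcongr
  have e2 : ((i + 1 : ℕ) : ℝ) / K ≤ (j : ℝ) / K := by gcongr; exact hlt
  have e3 : ((j + 1 : ℕ) : ℝ) / K ≤ ((b + 1 : ℕ) : ℝ) / K := by have := hj.2; gcongr
  have hle : ξ ≤ η := by linarith [hξ.2, hη.1]
  refine mul_le_mul_of_nonneg_left (h ⟨?_, ?_⟩ ⟨?_, ?_⟩ hle) (by positivity)
  all_goals linarith [hξ.1, hξ.2, hη.1, hη.2]

theorem increment_antitoneOn (hα : ContDiffOn ℝ 1 α (Icc 0 1)) (N : ℕ) {K a b : ℕ} (hb : b < K)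
    (h : AntitoneOn (derivWithin α (Icc 0 1)) (Icc ((a : ℝ) / K) (((b + 1 : ℕ) : ℝ) / K))) :
    AntitoneOn (increment α N K) (Icc a b) := by
  intro i hi j hj hij
  rcases hij.eq_or_lt with rfl | hlt
  · exact le_rfl
  obtain ⟨ξ, hξ, h1⟩ := exists_increment_eq hα N (hi.2.trans_lt hb)
  obtain ⟨η, hη, h2⟩ := exists_increment_eq hα N (hj.2.trans_lt hb)
  rw [h1, h2]
  have e1 : (a : ℝ) / K ≤ (i : ℝ) / K := by have := hi.1; gcongr
  have e2 : ((i + 1 : ℕ) : ℝ) / K ≤ (j : ℝ) / K := by gcongr; exact hlt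
  have e3 : ((j + 1 : ℕ) : ℝ) / K ≤ ((b + 1 : ℕ) : ℝ) / K := by have := hj.2; gcongr
  have hle : ξ ≤ η := by linarith [hξ.2, hη.1]
  refine mul_le_mul_of_nonneg_left (h ⟨?_, ?_⟩ ⟨?_, ?_⟩ hle) (by positivity)
  all_goals linarith [hξ.1, hξ.2, hη.1, hη.2]

/-- The variation of the integer parts of the increments is bounded independently of `N` and
`K`. -/
theorem exists_bound_variation_floor_increment (hα : ContDiffOn ℝ 1 α (Icc 0 1))
    (hpm : IsPiecewiseMonotone (derivWithin α (Icc 0 1))) :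
    ∃ V : ℝ, ∀ (N n : ℕ) (M : ℝ), (∀ k < n + 1, increment α N (n + 1) k ∈ Icc 0 M) →
      ∑ k ∈ Finset.range n, |(⌊increment α N (n + 1) (k + 1)⌋ : ℝ) - ⌊increment α N (n + 1) k⌋|
        ≤ M * V := by
  obtain ⟨S, hS⟩ := hpm
  refine ⟨2 * (2 * S.card) + 1, fun N n M hM => ?_⟩
  obtain ⟨B, hBcard, hB⟩ := exists_finset_of_cells S (Nat.succ_pos n)
  have hM0 : 0 ≤ M := (hM 0 (Nat.succ_pos n)).1.trans (hM 0 (Nat.succ_pos n)).2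
  have hfl : Monotone fun x : ℝ => (⌊x⌋ : ℝ) := fun x y h =>
    Int.cast_mono (Int.floor_le_floor h)
  have hBc : (B.card : ℝ) ≤ 2 * S.card := by exact_mod_cast hBcard
  refine (sum_abs_sub_le_of_piecewise_monotone
    (y := fun k => (⌊increment α N (n + 1) k⌋ : ℝ)) (M := M) (B := B) ?_ ?_).trans (by gcongr)
  · intro k hk
    have h := hM k (Nat.lt_succ_of_le hk)
    exact ⟨by exact_mod_cast Int.floor_nonneg.2 h.1, (Int.floor_le _).trans h.2⟩
  · intro a b hab hb hrun
    have hK : (0 : ℝ) < ((n + 1 : ℕ) : ℝ) := by positivity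
    have hno : ∀ t ∈ S, t ∉ Ioo ((a : ℝ) / (n + 1 : ℕ)) (((b + 1 : ℕ) : ℝ) / (n + 1 : ℕ)) := by
      intro t ht ⟨h1, h2⟩
      rw [div_lt_iff₀ hK] at h1
      rw [lt_div_iff₀ hK] at h2
      have h3 : a < ⌈t * (n + 1 : ℕ)⌉₊ := Nat.lt_ceil.2 h1
      have h4 : ⌈t * (n + 1 : ℕ)⌉₊ ≤ b + 1 := Nat.ceil_le.2 h2.le
      have h5 : t * (n + 1 : ℕ) ≤ ⌈t * (n + 1 : ℕ)⌉₊ := Nat.le_ceil _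
      have h6 : (⌈t * (n + 1 : ℕ)⌉₊ : ℝ) < t * (n + 1 : ℕ) + 1 :=
        Nat.ceil_lt_add_one ((Nat.cast_nonneg a).trans h1.le)
      set c := ⌈t * (n + 1 : ℕ)⌉₊
      -- The point t lies in cell c-1. The double cell starting at c-1 belongs to the run unless c =
      -- b+1; in that last cell the double cell starting at b-1 is used.
      rcases Nat.lt_or_ge c (b + 1) with h | h
      · refine hrun (c - 1) (Finset.mem_Ico.2 ⟨by omega, by omega⟩) (hB _ t ht ⟨?_, ?_⟩)
        · rw [div_lt_iff₀ hK, Nat.cast_sub (by omega)]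
          push_cast at *
          linarith
        · rw [lt_div_iff₀ hK, show c - 1 + 2 = c + 1 by omega]
          push_cast at *
          linarith
      · obtain rfl | hab' := Nat.eq_zero_or_pos b
        · omega
        have hc : c = b + 1 := by omega
        refine hrun (b - 1) (Finset.mem_Ico.2 ⟨by omega, by omega⟩) (hB _ t ht ⟨?_, ?_⟩)
        · rw [div_lt_iff₀ hK, Nat.cast_sub (by omega)]
          rw [hc] at h6
          push_cast at *
          linarith
        · rw [lt_div_iff₀ hK, show b - 1 + 2 = b + 1 by omega]
          exact h2
    have hb' : b < n + 1 := Nat.lt_succ_of_le hb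
    have hlt : (a : ℝ) / (n + 1 : ℕ) < ((b + 1 : ℕ) : ℝ) / (n + 1 : ℕ) := by gcongr; omega
    rcases hS _ _ (div_mem_Icc_zero_one (hab.le.trans hb'.le)).1 hlt
      (div_mem_Icc_zero_one (show b + 1 ≤ n + 1 from hb')).2 hno with h | h
    · exact Or.inl fun i hi j hj hij => hfl (increment_monotoneOn hα N hb' h hi hj hij)
    · exact Or.inr fun i hi j hj hij => hfl (increment_antitoneOn hα N hb' h hi hj hij)

end Curve

/-! ### Rounding the schedule to integers. -/

section Schedule

variable {α : ℝ → ℝ}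

theorem mem_Icc_of_monotoneOn (hmono : MonotoneOn α (Icc 0 1)) (h0 : α 0 = 0) (h1 : α 1 = 1)
    {t : ℝ} (ht : t ∈ Icc (0 : ℝ) 1) : α t ∈ Icc (0 : ℝ) 1 :=
  ⟨h0 ▸ hmono (left_mem_Icc.2 zero_le_one) ht ht.1,
    h1 ▸ hmono ht (right_mem_Icc.2 zero_le_one) ht.2⟩

theorem schedule_zero (h0 : α 0 = 0) (N K : ℕ) : schedule α N K 0 = 0 := by
  simp [schedule, h0]

theorem schedule_last (h1 : α 1 = 1) (N : ℕ) {K : ℕ} (hK : 0 < K) : schedule α N K K = N := by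
  have : (K : ℝ) ≠ 0 := by positivity
  simp [schedule, this, h1]

theorem schedule_mono (hmono : MonotoneOn α (Icc 0 1)) (N : ℕ) {K j k : ℕ} (hjk : j ≤ k)
    (hk : k ≤ K) : schedule α N K j ≤ schedule α N K k := by
  refine Nat.ceil_le_ceil (mul_le_mul_of_nonneg_left ?_ (by positivity))
  exact hmono (div_mem_Icc_zero_one (hjk.trans hk)) (div_mem_Icc_zero_one hk) (by gcongr)

/-- The rounding error of the schedule. -/
noncomputable def roundingError (α : ℝ → ℝ) (N K k : ℕ) : ℝ :=
  schedule α N K k - N * α ((k : ℝ) / K)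

theorem roundingError_mem_Ico {N K k : ℕ} (h : 0 ≤ α ((k : ℝ) / K)) :
    roundingError α N K k ∈ Ico (0 : ℝ) 1 := by
  have h1 : (0 : ℝ) ≤ N * α ((k : ℝ) / K) := by positivity
  have h2 := Nat.le_ceil ((N : ℝ) * α ((k : ℝ) / K))
  have h3 := Nat.ceil_lt_add_one h1
  constructor <;> · rw [roundingError, schedule]; linarith

theorem schedule_sub_eq (N K k : ℕ) :
    (schedule α N K (k + 1) : ℝ) - schedule α N K k
      = increment α N K k + (roundingError α N K (k + 1) - roundingError α N K k) := by
  rw [roundingError, roundingError, increment]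
  ring

/-- Two rounding errors in [0,1) differ by less than 1, so the integer step is ⌊x⌋ or ⌊x⌋+1 and
`sq_sub_interpSq` applies. -/
theorem schedule_sub_sq (hα : ∀ t ∈ Icc (0 : ℝ) 1, 0 ≤ α t) (N : ℕ) {K k : ℕ} (hk : k < K) :
    ((schedule α N K (k + 1) : ℝ) - schedule α N K k) ^ 2 - interpSq (increment α N K k)
      = (2 * (⌊increment α N K k⌋ : ℝ) + 1)
        * (roundingError α N K (k + 1) - roundingError α N K k) := by
  have h0 := roundingError_mem_Ico (N := N) (hα _ (div_mem_Icc_zero_one hk.le))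
  have h1 := roundingError_mem_Ico (N := N) (hα _ (div_mem_Icc_zero_one (show k + 1 ≤ K from hk)))
  have h := schedule_sub_eq (α := α) N K k
  set x := increment α N K k
  set n : ℤ := (schedule α N K (k + 1) : ℤ) - schedule α N K k with hn
  have hnc : (n : ℝ) = (schedule α N K (k + 1) : ℝ) - schedule α N K k := by simp [hn]
  rw [← hnc] at h ⊢
  have hf1 := Int.floor_le x
  have hf2 := Int.lt_floor_add_one x
  have h2 : ⌊x⌋ - 1 < n := by
    have : ((⌊x⌋ - 1 : ℤ) : ℝ) < n := by push_cast; linarith [h0.1, h0.2, h1.1, h1.2]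
    exact_mod_cast this
  have h3 : n < ⌊x⌋ + 2 := by
    have : (n : ℝ) < ((⌊x⌋ + 2 : ℤ) : ℝ) := by push_cast; linarith [h0.1, h0.2, h1.1, h1.2]
    exact_mod_cast this
  rw [sq_sub_interpSq (by omega) (by omega), h]
  ring

end Schedule

/-! ### Limits of the weighted sums over steps. -/

section Limits

theorem tendsto_zero_of_forall_eventually_le_mul {ι : Type*} {l : Filter ι} {u : ι → ℝ} (C : ℝ)
    (h : ∀ δ > 0, ∀ᶠ i in l, |u i| ≤ C * δ) : Tendsto u l (𝓝 0) := by
  rw [Metric.tendsto_nhds]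
  intro ε hε
  have hC : 0 < |C| + 1 := by positivity
  filter_upwards [h (ε / (|C| + 1)) (by positivity)] with i hi
  rw [Real.dist_0_eq_abs]
  refine hi.trans_lt ?_
  calc C * (ε / (|C| + 1)) ≤ |C| * (ε / (|C| + 1)) := by gcongr; exact le_abs_self C
    _ < (|C| + 1) * (ε / (|C| + 1)) := by gcongr; linarith
    _ = ε := by field_simp

theorem exists_modulus {F : ℝ → ℝ} (hF : ContinuousOn F (Icc 0 1)) {δ : ℝ} (hδ : 0 < δ) :
    ∃ η > 0, ∀ x ∈ Icc (0 : ℝ) 1, ∀ y ∈ Icc (0 : ℝ) 1, |x - y| < η → |F x - F y| ≤ δ := by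
  obtain ⟨η, hη, h⟩ := Metric.uniformContinuousOn_iff.1
    (isCompact_Icc.uniformContinuousOn_of_continuous hF) δ hδ
  exact ⟨η, hη, fun x hx y hy hxy => (h x hx y hy hxy).le⟩

theorem exists_abs_le {F : ℝ → ℝ} (hF : ContinuousOn F (Icc 0 1)) :
    ∃ B, 0 ≤ B ∧ ∀ t ∈ Icc (0 : ℝ) 1, |F t| ≤ B := by
  obtain ⟨B, hB⟩ := isCompact_Icc.exists_bound_of_continuousOn hF
  exact ⟨B, (norm_nonneg _).trans (hB 0 (by simp)), hB⟩

theorem eventually_div_lt {ι : Type*} {l : Filter ι} {K : ι → ℕ} (hK : Tendsto K l atTop)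
    (c : ℝ) {η : ℝ} (hη : 0 < η) : ∀ᶠ i in l, c / (K i : ℝ) < η :=
  (Tendsto.const_div_atTop (tendsto_natCast_atTop_atTop.comp hK) c).eventually_lt_const hη

/-- Uniform continuity on the cells `[k/K, (k+1)/K]`. -/
theorem eventually_oscillation_le {ι : Type*} {l : Filter ι} {K : ι → ℕ} (hK : Tendsto K l atTop)
    {F : ℝ → ℝ} (hF : ContinuousOn F (Icc 0 1)) {δ : ℝ} (hδ : 0 < δ) :
    ∀ᶠ i in l, ∀ k < K i, ∀ x ∈ Icc ((k : ℝ) / K i) (((k + 1 : ℕ) : ℝ) / K i),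
      ∀ y ∈ Icc ((k : ℝ) / K i) (((k + 1 : ℕ) : ℝ) / K i), |F x - F y| ≤ δ := by
  obtain ⟨η, hη, h⟩ := exists_modulus hF hδ
  filter_upwards [eventually_div_lt hK 1 hη] with i hi k hk x hx y hy
  have h0 := div_mem_Icc_zero_one hk.le
  have h1 := div_mem_Icc_zero_one (show k + 1 ≤ K i from hk)
  have hd : ((k + 1 : ℕ) : ℝ) / K i = (k : ℝ) / K i + 1 / K i := by push_cast; ring
  refine h x ⟨h0.1.trans hx.1, hx.2.trans h1.2⟩ y ⟨h0.1.trans hy.1, hy.2.trans h1.2⟩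
    (lt_of_le_of_lt ?_ hi)
  rw [abs_le]
  constructor <;> linarith [hx.1, hx.2, hy.1, hy.2]

/-- Convergence of Riemann sums with perturbed values. -/
theorem tendsto_riemann_sum {ι : Type*} {l : Filter ι} {K : ι → ℕ} (hK : Tendsto K l atTop)
    {F : ℝ → ℝ} (hF : ContinuousOn F (Icc 0 1)) {c : ι → ℕ → ℝ} (C : ℝ)
    (hc : ∀ δ > 0, ∀ᶠ i in l, ∀ k < K i,
      ∀ t ∈ Icc ((k : ℝ) / K i) (((k + 1 : ℕ) : ℝ) / K i), |c i k - F t| ≤ C * δ) :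
    Tendsto (fun i => 1 / (K i : ℝ) * ∑ k ∈ Finset.range (K i), c i k) l
      (𝓝 (∫ t in (0 : ℝ)..1, F t)) := by
  rw [← tendsto_sub_nhds_zero_iff]
  refine tendsto_zero_of_forall_eventually_le_mul C fun δ hδ => ?_
  filter_upwards [hc δ hδ, hK.eventually_gt_atTop 0] with i hi hKi
  have hK0 : (0 : ℝ) < K i := by exact_mod_cast hKi
  have hint : ∀ k < K i, IntervalIntegrable F MeasureTheory.volume ((k : ℝ) / K i)
      (((k + 1 : ℕ) : ℝ) / K i) := fun k hk => by
    refine ContinuousOn.intervalIntegrable_of_Icc (div_lt_div_succ hk).le (hF.mono ?_)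
    exact Icc_subset_Icc (div_mem_Icc_zero_one hk.le).1
      (div_mem_Icc_zero_one (show k + 1 ≤ K i from hk)).2
  have hsum := intervalIntegral.sum_integral_adjacent_intervals (μ := MeasureTheory.volume)
    (f := F) (a := fun k : ℕ => (k : ℝ) / K i) (n := K i) hint
  simp only [Nat.cast_zero, zero_div, div_self hK0.ne'] at hsum
  have hd : ∀ k : ℕ, ((k + 1 : ℕ) : ℝ) / K i - (k : ℝ) / K i = 1 / K i := fun k => by
    push_cast; ring
  rw [← hsum, Finset.mul_sum, ← Finset.sum_sub_distrib]
  refine (Finset.abs_sum_le_sum_abs _ _).trans ?_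
  calc _ ≤ ∑ k ∈ Finset.range (K i), C * δ * (1 / K i) := by
        refine Finset.sum_le_sum fun k hk => ?_
        rw [Finset.mem_range] at hk
        have hle := (div_lt_div_succ hk).le
        have h1 : 1 / (K i : ℝ) * c i k - ∫ t in (k : ℝ) / K i..((k + 1 : ℕ) : ℝ) / K i, F t
            = ∫ t in (k : ℝ) / K i..((k + 1 : ℕ) : ℝ) / K i, (c i k - F t) := by
          rw [intervalIntegral.integral_sub intervalIntegrable_const (hint k hk),
            intervalIntegral.integral_const, hd, smul_eq_mul]
        rw [h1, ← Real.norm_eq_abs]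
        refine (intervalIntegral.norm_integral_le_of_norm_le_const (C := C * δ) ?_).trans ?_
        · intro t ht
          rw [uIoc_of_le hle] at ht
          exact hi k hk t ⟨ht.1.le, ht.2⟩
        · rw [hd, abs_of_nonneg (by positivity)]
    _ = C * δ := by
        rw [Finset.sum_const, Finset.card_range, nsmul_eq_mul]
        field_simp

/-- For constant φ the triangular sum is c n(n-1)/2 with n = b - a. Only indices with j+1 < b occur,
which matches the range where the rescaled profile is controlled. -/
theorem abs_two_mul_sum_sum_sub_le {φ : ℕ → ℝ} {a b : ℕ} (hab : a ≤ b) {c δ : ℝ}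
    (h : ∀ j, a ≤ j → j + 1 < b → |φ j - c| ≤ δ) :
    |2 * ∑ i ∈ Finset.Ico a b, ∑ j ∈ Finset.Ico a i, φ j - c * (((b : ℝ) - a) * (b - a - 1))|
      ≤ δ * (((b : ℝ) - a) * (b - a - 1)) := by
  have htri : ∀ d : ℝ, 2 * ∑ i ∈ Finset.Ico a b, ∑ _j ∈ Finset.Ico a i, d
      = d * (((b : ℝ) - a) * (b - a - 1)) := by
    intro d
    clear h
    induction b, hab using Nat.le_induction with
    | base => simp
    | succ n hn ih =>
      rw [Finset.sum_Ico_succ_top hn, mul_add, ih, Finset.sum_const, Nat.card_Ico, nsmul_eq_mul,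
        Nat.cast_sub hn]
      push_cast
      ring
  rw [← htri c, ← htri δ, ← mul_sub, ← Finset.sum_sub_distrib, abs_mul, abs_two]
  refine mul_le_mul_of_nonneg_left ((Finset.abs_sum_le_sum_abs _ _).trans ?_) zero_le_two
  refine Finset.sum_le_sum fun i hi => ?_
  rw [← Finset.sum_sub_distrib]
  refine (Finset.abs_sum_le_sum_abs _ _).trans (Finset.sum_le_sum fun j hj => ?_)
  rw [Finset.mem_Ico] at hi hj
  exact h j hj.1 (by omega)

variable {ι : Type*} {l : Filter ι} {α G : ℝ → ℝ} {s : ℝ} {N K : ι → ℕ}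

/-- There are K ~ N/s terms of order 1, so the termwise bound gives only O(1). Summation by parts
moves the difference onto the weights, whose variation is o(K) from G plus O(1) from the floors. -/
theorem tendsto_weighted_rounding_sum (hα : ContDiffOn ℝ 1 α (Icc 0 1))
    (hmono : MonotoneOn α (Icc 0 1)) (h0 : α 0 = 0) (h1 : α 1 = 1)
    (hpm : IsPiecewiseMonotone (derivWithin α (Icc 0 1))) (hG : ContinuousOn G (Icc 0 1))
    (hs : 0 < s) (hN : Tendsto N l atTop) (hK : Tendsto K l atTop)
    (hNK : Tendsto (fun i => (N i : ℝ) / K i) l (𝓝 s)) :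
    Tendsto (fun i => 1 / (N i : ℝ) * ∑ k ∈ Finset.range (K i), G ((k : ℝ) / K i)
      * (((schedule α (N i) (K i) (k + 1) : ℝ) - schedule α (N i) (K i) k) ^ 2
        - interpSq (increment α (N i) (K i) k))) l (𝓝 0) := by
  have hder : ContinuousOn (derivWithin α (Icc 0 1)) (Icc 0 1) :=
    hα.continuousOn_derivWithin (uniqueDiffOn_Icc zero_lt_one) le_rfl
  obtain ⟨L, hL0, hL⟩ := exists_abs_le hder
  obtain ⟨B, hB0, hB⟩ := exists_abs_le hG
  obtain ⟨V, hV⟩ := exists_bound_variation_floor_increment hα hpm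
  have hα0 : ∀ t ∈ Icc (0 : ℝ) 1, 0 ≤ α t := fun t ht => (mem_Icc_of_monotoneOn hmono h0 h1 ht).1
  set M := (s + 1) * L with hM
  have hM0 : 0 ≤ M := by positivity
  have hKN : Tendsto (fun i => (K i : ℝ) / N i) l (𝓝 s⁻¹) := by
    simpa using hNK.inv₀ hs.ne'
  -- The first summand is K/N ≤ s⁻¹+1 times the oscillation of G against weights at most 2M+1; the
  -- final 1 absorbs the floor variation 2BMV/N.
  refine tendsto_zero_of_forall_eventually_le_mul ((2 * M + 1) * (s⁻¹ + 1) + 1) fun δ hδ => ?_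
  filter_upwards [hNK.eventually_le_const (lt_add_one s), hKN.eventually_le_const (lt_add_one s⁻¹),
    eventually_div_lt hN (2 * B * (M * V)) hδ, eventually_oscillation_le hK hG hδ,
    hK.eventually_gt_atTop 0, hN.eventually_gt_atTop 0] with i hr hr' hNδ hosc hKi hNi
  obtain ⟨n, hn⟩ : ∃ n, K i = n + 1 := ⟨K i - 1, by omega⟩
  have hN0 : (0 : ℝ) < N i := by exact_mod_cast hNi
  have hinc : ∀ k < K i, increment α (N i) (K i) k ∈ Icc 0 M := fun k hk =>
    increment_mem_Icc hα hmono (fun t ht => (le_abs_self _).trans (hL t ht)) hr hk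
  have hTV := hV (N i) n M (by rw [← hn]; exact hinc)
  rw [← hn] at hTV
  set c : ℕ → ℝ := fun k => ⌊increment α (N i) (K i) k⌋ with hc
  have hcb : ∀ k < K i, |2 * c k + 1| ≤ 2 * M + 1 := fun k hk => by
    have h := hinc k hk
    have h2 : 0 ≤ c k := Int.cast_nonneg (Int.floor_nonneg.2 h.1)
    have h3 : c k ≤ M := (Int.floor_le _).trans h.2
    rw [abs_of_nonneg (by positivity)]
    linarith
  set w : ℕ → ℝ := fun k => G ((k : ℝ) / K i) * (2 * c k + 1) with hw
  set θ : ℕ → ℝ := roundingError α (N i) (K i) with hθ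
  have hsum : ∑ k ∈ Finset.range (K i), G ((k : ℝ) / K i)
      * (((schedule α (N i) (K i) (k + 1) : ℝ) - schedule α (N i) (K i) k) ^ 2
        - interpSq (increment α (N i) (K i) k))
      = ∑ k ∈ Finset.range (n + 1), w k * (θ (k + 1) - θ k) := by
    rw [← hn]
    refine Finset.sum_congr rfl fun k hk => ?_
    rw [schedule_sub_sq hα0 _ (Finset.mem_range.1 hk), hw, mul_assoc]
  have habel := abs_sum_mul_sub_le w θ n
    (by simp [hθ, roundingError, schedule_zero h0, h0])
    (by
      have : (K i : ℝ) ≠ 0 := by positivity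
      rw [← hn, hθ, roundingError, schedule_last h1 _ hKi, div_self this, h1]; ring)
    (fun k hk => by
      have h := roundingError_mem_Ico (N := N i)
        (hα0 _ (div_mem_Icc_zero_one (show k ≤ K i by omega)))
      rw [abs_of_nonneg h.1]
      exact h.2.le)
  have hvar : ∑ k ∈ Finset.range n, |w (k + 1) - w k|
      ≤ K i * ((2 * M + 1) * δ) + 2 * B * (M * V) := by
    calc ∑ k ∈ Finset.range n, |w (k + 1) - w k|
        ≤ ∑ k ∈ Finset.range n, ((2 * M + 1) * δ + 2 * B * |c (k + 1) - c k|) := by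
          refine Finset.sum_le_sum fun k hk => ?_
          have hk' : k < n := Finset.mem_range.1 hk
          have hkK : k < K i := by omega
          have hle := (div_lt_div_succ hkK).le
          have e : w (k + 1) - w k
              = (2 * c (k + 1) + 1) * (G (((k + 1 : ℕ) : ℝ) / K i) - G ((k : ℝ) / K i))
                + 2 * G ((k : ℝ) / K i) * (c (k + 1) - c k) := by
            simp only [hw]; ring
          rw [e]
          refine (abs_add_le _ _).trans (add_le_add ?_ ?_)
          · rw [abs_mul]
            exact mul_le_mul (hcb _ (by omega)) (hosc k hkK _ (right_mem_Icc.2 hle) _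
              (left_mem_Icc.2 hle)) (abs_nonneg _) (by positivity)
          · rw [abs_mul, abs_mul, abs_two]
            gcongr
            exact hB _ (div_mem_Icc_zero_one hkK.le)
      _ = n * ((2 * M + 1) * δ) + 2 * B * ∑ k ∈ Finset.range n, |c (k + 1) - c k| := by
          rw [Finset.sum_add_distrib, Finset.sum_const, Finset.card_range, nsmul_eq_mul,
            Finset.mul_sum]
      _ ≤ _ := by
          gcongr
          omega
  rw [hsum, abs_mul, abs_of_pos (by positivity : 0 < 1 / (N i : ℝ))]
  calc 1 / (N i : ℝ) * |∑ k ∈ Finset.range (n + 1), w k * (θ (k + 1) - θ k)|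
      ≤ 1 / (N i : ℝ) * (K i * ((2 * M + 1) * δ) + 2 * B * (M * V)) := by
        gcongr
        exact habel.trans hvar
    _ = (K i : ℝ) / N i * ((2 * M + 1) * δ) + 2 * B * (M * V) / N i := by ring
    _ ≤ (s⁻¹ + 1) * ((2 * M + 1) * δ) + δ := by gcongr
    _ = _ := by ring

/-- Each increment is (N/K) α'(ξ), close to s α'. The prefactor 1/N is (K/N)(1/K), giving s⁻¹, and
`interpSq` (s u) = s² h(u) turns this into s. -/
theorem tendsto_weighted_interpSq_sum (hα : ContDiffOn ℝ 1 α (Icc 0 1))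
    (hmono : MonotoneOn α (Icc 0 1)) (hG : ContinuousOn G (Icc 0 1))
    (hs : 0 < s) (hK : Tendsto K l atTop)
    (hNK : Tendsto (fun i => (N i : ℝ) / K i) l (𝓝 s)) :
    Tendsto (fun i => 1 / (N i : ℝ) * ∑ k ∈ Finset.range (K i), G ((k : ℝ) / K i)
      * interpSq (increment α (N i) (K i) k)) l
      (𝓝 (s * ∫ t in (0 : ℝ)..1, G t * quantSq s (derivWithin α (Icc 0 1) t))) := by
  have hder : ContinuousOn (derivWithin α (Icc 0 1)) (Icc 0 1) :=
    hα.continuousOn_derivWithin (uniqueDiffOn_Icc zero_lt_one) le_rfl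
  obtain ⟨L, hL0, hL⟩ := exists_abs_le hder
  obtain ⟨B, hB0, hB⟩ := exists_abs_le hG
  set M := (s + 1) * L with hM
  have hM0 : 0 ≤ M := by positivity
  have hd0 : ∀ t, 0 ≤ derivWithin α (Icc 0 1) t := fun t => hmono.derivWithin_nonneg
  have hdM : ∀ t ∈ Icc (0 : ℝ) 1, s * derivWithin α (Icc 0 1) t ∈ Icc 0 M := fun t ht =>
    ⟨mul_nonneg hs.le (hd0 t), mul_le_mul (by linarith) ((le_abs_self _).trans (hL t ht)) (hd0 t)
      (by linarith)⟩
  have hF : ContinuousOn (fun t => G t * interpSq (s * derivWithin α (Icc 0 1) t)) (Icc 0 1) :=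
    hG.mul ((continuousOn_interpSq M).comp (continuousOn_const.mul hder) hdM)
  have hriem := tendsto_riemann_sum hK hF
    (c := fun i k => G ((k : ℝ) / K i) * interpSq (increment α (N i) (K i) k))
    -- First summand: Lipschitz bound for `interpSq` with arguments (L+s)δ apart. Second:
    -- oscillation of G times the bound on `interpSq`.
    (B * ((2 * M + 1) * (L + s)) + (2 * M + 1) * M) fun δ hδ => by
      filter_upwards [hNK.eventually_le_const (lt_add_one s),
        (tendsto_iff_dist_tendsto_zero.1 hNK).eventually_le_const hδ,
        eventually_oscillation_le hK hG hδ, eventually_oscillation_le hK hder hδ]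
        with i hr hdist hoscG hoscd k hk t ht
      have hle := (div_lt_div_succ hk).le
      have hsub : Icc ((k : ℝ) / K i) (((k + 1 : ℕ) : ℝ) / K i) ⊆ Icc 0 1 :=
        Icc_subset_Icc (div_mem_Icc_zero_one hk.le).1
          (div_mem_Icc_zero_one (show k + 1 ≤ K i from hk)).2
      have hinc : increment α (N i) (K i) k ∈ Icc 0 M :=
        increment_mem_Icc hα hmono (fun t ht => (le_abs_self _).trans (hL t ht)) hr hk
      obtain ⟨ξ, hξ, hx⟩ := exists_increment_eq hα (N i) hk
      have hξ' := Ioo_subset_Icc_self hξ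
      have hdiff : |increment α (N i) (K i) k - s * derivWithin α (Icc 0 1) t|
          ≤ (L + s) * δ := by
        have e : increment α (N i) (K i) k - s * derivWithin α (Icc 0 1) t
            = ((N i : ℝ) / K i - s) * derivWithin α (Icc 0 1) ξ
              + s * (derivWithin α (Icc 0 1) ξ - derivWithin α (Icc 0 1) t) := by rw [hx]; ring
        rw [e]
        refine (abs_add_le _ _).trans ?_
        rw [abs_mul, abs_mul, abs_of_pos hs]
        rw [Real.dist_eq] at hdist
        have h1 := mul_le_mul hdist (hL ξ (hsub hξ')) (abs_nonneg _) hδ.le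
        have h2 := mul_le_mul_of_nonneg_left (hoscd k hk ξ hξ' t ht) hs.le
        linarith
      have e : G ((k : ℝ) / K i) * interpSq (increment α (N i) (K i) k)
          - G t * interpSq (s * derivWithin α (Icc 0 1) t)
          = G ((k : ℝ) / K i) * (interpSq (increment α (N i) (K i) k)
            - interpSq (s * derivWithin α (Icc 0 1) t))
            + (G ((k : ℝ) / K i) - G t) * interpSq (s * derivWithin α (Icc 0 1) t) := by ring
      rw [e]
      refine (abs_add_le _ _).trans ?_
      rw [abs_mul, abs_mul]
      have hb := interpSq_mem_Icc (hdM t (hsub ht))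
      have h1 : |interpSq (increment α (N i) (K i) k)
          - interpSq (s * derivWithin α (Icc 0 1) t)| ≤ (2 * M + 1) * ((L + s) * δ) :=
        (abs_interpSq_sub_le hinc (hdM t (hsub ht))).trans (by gcongr)
      have h2 := mul_le_mul (hB _ (div_mem_Icc_zero_one hk.le)) h1 (abs_nonneg _) hB0
      have h3 := mul_le_mul (hoscG k hk _ (left_mem_Icc.2 hle) t ht)
        ((abs_of_nonneg hb.1).trans_le hb.2) (abs_nonneg _) hδ.le
      linarith
  have hKN : Tendsto (fun i => (K i : ℝ) / N i) l (𝓝 s⁻¹) := by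
    simpa using hNK.inv₀ hs.ne'
  have hprod := hKN.mul hriem
  have hlim : s * ∫ t in (0 : ℝ)..1, G t * quantSq s (derivWithin α (Icc 0 1) t)
      = s⁻¹ * ∫ t in (0 : ℝ)..1, G t * interpSq (s * derivWithin α (Icc 0 1) t) := by
    have : ∀ t, G t * quantSq s (derivWithin α (Icc 0 1) t)
        = (s ^ 2)⁻¹ * (G t * interpSq (s * derivWithin α (Icc 0 1) t)) := fun t => by
      rw [quantSq_eq_interpSq]; ring
    simp only [this]
    rw [intervalIntegral.integral_const_mul, ← mul_assoc]
    congr 1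
    field_simp
  rw [hlim]
  refine hprod.congr' ?_
  filter_upwards [hK.eventually_gt_atTop 0] with i hKi
  have hK0 : (K i : ℝ) ≠ 0 := by positivity
  rw [← mul_assoc]
  congr 1
  field_simp

end Limits

/-! ### Replacing the rescaled profile by its limit. -/

section Profile

variable {ι : Type*} {l : Filter ι} {α g : ℝ → ℝ} {s : ℝ} {N K : ι → ℕ}

theorem exists_bound_schedule_sub (hα : ContDiffOn ℝ 1 α (Icc 0 1))
    (hmono : MonotoneOn α (Icc 0 1)) (h0 : α 0 = 0) (h1 : α 1 = 1)
    (hNK : Tendsto (fun i => (N i : ℝ) / K i) l (𝓝 s)) :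
    ∃ C, 0 ≤ C ∧ ∀ᶠ i in l, ∀ k < K i,
      (schedule α (N i) (K i) (k + 1) : ℝ) - N i * α ((k : ℝ) / K i) ≤ C := by
  have hder : ContinuousOn (derivWithin α (Icc 0 1)) (Icc 0 1) :=
    hα.continuousOn_derivWithin (uniqueDiffOn_Icc zero_lt_one) le_rfl
  obtain ⟨L, hL0, hL⟩ := exists_abs_le hder
  refine ⟨(|s| + 1) * L + 1, by positivity, ?_⟩
  filter_upwards [hNK.eventually_le_const (show s < |s| + 1 by linarith [le_abs_self s])]
    with i hr k hk
  have hinc := increment_mem_Icc hα hmono (fun t ht => (le_abs_self _).trans (hL t ht)) hr hk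
  have hθ := roundingError_mem_Ico (N := N i)
    (mem_Icc_of_monotoneOn hmono h0 h1 (div_mem_Icc_zero_one (show k + 1 ≤ K i from hk))).1
  have h2 := hinc.2
  have h3 := hθ.2
  rw [increment] at h2
  rw [roundingError] at h3
  linarith

/-- Within a step of the schedule, `g` is close to its value at the start. -/
theorem eventually_abs_sub_schedule_le (hα : ContDiffOn ℝ 1 α (Icc 0 1))
    (hmono : MonotoneOn α (Icc 0 1)) (h0 : α 0 = 0) (h1 : α 1 = 1) (hg : ContinuousOn g (Icc 0 1))
    (hN : Tendsto N l atTop) (hK : Tendsto K l atTop)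
    (hNK : Tendsto (fun i => (N i : ℝ) / K i) l (𝓝 s)) {δ : ℝ} (hδ : 0 < δ) :
    ∀ᶠ i in l, ∀ k < K i, ∀ j, schedule α (N i) (K i) k ≤ j → j < schedule α (N i) (K i) (k + 1) →
      |g ((j : ℝ) / N i) - g (α ((k : ℝ) / K i))| ≤ δ := by
  obtain ⟨C, hC0, hC⟩ := exists_bound_schedule_sub hα hmono h0 h1 hNK
  obtain ⟨η, hη, h⟩ := exists_modulus hg hδ
  filter_upwards [hC, eventually_div_lt hN C hη, hN.eventually_gt_atTop 0,
    hK.eventually_gt_atTop 0] with i hi hCN hNi hKi k hk j hj1 hj2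
  have hN0 : (0 : ℝ) < N i := by exact_mod_cast hNi
  have hle : schedule α (N i) (K i) (k + 1) ≤ N i :=
    (schedule_mono hmono _ (show k + 1 ≤ K i from hk) le_rfl).trans (schedule_last h1 _ hKi).le
  have hαk := mem_Icc_of_monotoneOn hmono h0 h1 (div_mem_Icc_zero_one hk.le)
  have hθ := (roundingError_mem_Ico (N := N i) hαk.1).1
  rw [roundingError] at hθ
  refine h _ (div_mem_Icc_zero_one (by omega)) _ hαk ?_
  have e : (j : ℝ) / N i - α ((k : ℝ) / K i) = (j - N i * α ((k : ℝ) / K i)) / N i := by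
    field_simp
  have hj1' : (schedule α (N i) (K i) k : ℝ) ≤ j := by exact_mod_cast hj1
  have hj2' : (j : ℝ) ≤ schedule α (N i) (K i) (k + 1) := by exact_mod_cast hj2.le
  rw [e, abs_of_nonneg (div_nonneg (by linarith) hN0.le)]
  refine lt_of_le_of_lt ?_ hCN
  gcongr
  linarith [hi k hk]

theorem sum_schedule_sub (h0 : α 0 = 0) (h1 : α 1 = 1) (N : ℕ) {K : ℕ} (hK : 0 < K) :
    ∑ k ∈ Finset.range K, ((schedule α N K (k + 1) : ℝ) - schedule α N K k) = N := by
  rw [Finset.sum_range_sub (fun k => (schedule α N K k : ℝ)), schedule_last h1 N hK,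
    schedule_zero h0, Nat.cast_zero, sub_zero]

/-- The limit 1 comes from the exact normalization of φ, so the integral of g never has to be
computed. -/
theorem tendsto_weighted_schedule_sum (hα : ContDiffOn ℝ 1 α (Icc 0 1))
    (hmono : MonotoneOn α (Icc 0 1)) (h0 : α 0 = 0) (h1 : α 1 = 1) (hg : ContinuousOn g (Icc 0 1))
    (hN : Tendsto N l atTop) (hK : Tendsto K l atTop)
    (hNK : Tendsto (fun i => (N i : ℝ) / K i) l (𝓝 s)) {φ : ι → ℕ → ℝ}
    (hφ : ∀ δ > 0, ∀ᶠ i in l, ∀ j, j + 1 < N i → |φ i j - g ((j : ℝ) / N i)| ≤ δ)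
    (hsum : ∀ᶠ i in l, ∑ j ∈ Finset.range (N i - 1), φ i j = N i) :
    Tendsto (fun i => 1 / (N i : ℝ) * ∑ k ∈ Finset.range (K i), g (α ((k : ℝ) / K i))
      * ((schedule α (N i) (K i) (k + 1) : ℝ) - schedule α (N i) (K i) k)) l (𝓝 1) := by
  obtain ⟨B, hB0, hB⟩ := exists_abs_le hg
  rw [← tendsto_sub_nhds_zero_iff]
  -- One δ each for g within a step, φ against g, and the unmatched index N-1, whose term is at most
  -- B/N.
  refine tendsto_zero_of_forall_eventually_le_mul 3 fun δ hδ => ?_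
  filter_upwards [eventually_abs_sub_schedule_le hα hmono h0 h1 hg hN hK hNK hδ, hφ δ hδ, hsum,
    eventually_div_lt hN B hδ, hN.eventually_gt_atTop 0, hK.eventually_gt_atTop 0]
    with i hosc hφi hsumi hBN hNi hKi
  have hN0 : (0 : ℝ) < N i := by exact_mod_cast hNi
  set a := schedule α (N i) (K i) with ha
  have hstep : ∀ k < K i, a k ≤ a (k + 1) := fun k hk => schedule_mono hmono _ (Nat.le_succ k) hk
  have hsplit := sum_range_eq_sum_sum_Ico (fun j => g ((j : ℝ) / N i))
    (schedule_zero h0 (N i) (K i)) hstep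
  rw [schedule_last h1 _ hKi] at hsplit
  have hA : |∑ k ∈ Finset.range (K i), g (α ((k : ℝ) / K i)) * ((a (k + 1) : ℝ) - a k)
      - ∑ j ∈ Finset.range (N i), g ((j : ℝ) / N i)| ≤ N i * δ := by
    rw [hsplit, ← Finset.sum_sub_distrib]
    refine (Finset.abs_sum_le_sum_abs _ _).trans ?_
    have hNδ : (N i : ℝ) * δ = ∑ k ∈ Finset.range (K i), ((a (k + 1) : ℝ) - a k) * δ := by
      rw [← Finset.sum_mul, sum_schedule_sub h0 h1 (N i) hKi]
    rw [hNδ]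
    refine Finset.sum_le_sum fun k hk => ?_
    rw [Finset.mem_range] at hk
    have hcard : ∀ d : ℝ, ∑ _j ∈ Finset.Ico (a k) (a (k + 1)), d = ((a (k + 1) : ℝ) - a k) * d :=
      fun d => by rw [Finset.sum_const, Nat.card_Ico, nsmul_eq_mul, Nat.cast_sub (hstep k hk)]
    rw [mul_comm (g _), ← hcard, ← hcard, ← Finset.sum_sub_distrib]
    refine (Finset.abs_sum_le_sum_abs _ _).trans (Finset.sum_le_sum fun j hj => ?_)
    rw [Finset.mem_Ico] at hj
    rw [abs_sub_comm]
    exact hosc k hk j hj.1 hj.2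
  have hC : |∑ j ∈ Finset.range (N i), g ((j : ℝ) / N i) - N i| ≤ N i * δ + B := by
    obtain ⟨n, hn⟩ : ∃ n, N i = n + 1 := ⟨N i - 1, by omega⟩
    have hn1 : N i - 1 = n := by omega
    have e : ∑ j ∈ Finset.range (N i), g ((j : ℝ) / N i) - N i
        = g ((n : ℝ) / N i) + ∑ j ∈ Finset.range n, (g ((j : ℝ) / N i) - φ i j) := by
      rw [Finset.sum_sub_distrib, ← hn1, hsumi, hn1]
      nth_rewrite 1 [show Finset.range (N i) = Finset.range (n + 1) by rw [hn]]
      rw [Finset.sum_range_succ]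
      ring
    rw [e, add_comm (N i * δ)]
    refine (abs_add_le _ _).trans (add_le_add (hB _ (div_mem_Icc_zero_one (by omega))) ?_)
    refine (Finset.abs_sum_le_sum_abs _ _).trans ?_
    calc _ ≤ ∑ j ∈ Finset.range n, δ := by
          refine Finset.sum_le_sum fun j hj => ?_
          rw [Finset.mem_range] at hj
          rw [abs_sub_comm]
          exact hφi j (by omega)
      _ = n * δ := by rw [Finset.sum_const, Finset.card_range, nsmul_eq_mul]
      _ ≤ N i * δ := by gcongr; omega
  have hBN' : B ≤ N i * δ := by
    rw [div_lt_iff₀ hN0] at hBN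
    linarith
  set T := ∑ k ∈ Finset.range (K i), g (α ((k : ℝ) / K i)) * ((a (k + 1) : ℝ) - a k)
  have e : 1 / (N i : ℝ) * T - 1 = (T - N i) / N i := by field_simp
  rw [e, abs_div, abs_of_pos hN0, div_le_iff₀ hN0]
  have := abs_sub_le T (∑ j ∈ Finset.range (N i), g ((j : ℝ) / N i)) (N i)
  linarith

theorem tendsto_triangular_sum_sub (hα : ContDiffOn ℝ 1 α (Icc 0 1))
    (hmono : MonotoneOn α (Icc 0 1)) (h0 : α 0 = 0) (h1 : α 1 = 1) (hg : ContinuousOn g (Icc 0 1))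
    (hN : Tendsto N l atTop) (hK : Tendsto K l atTop)
    (hNK : Tendsto (fun i => (N i : ℝ) / K i) l (𝓝 s)) {φ : ι → ℕ → ℝ}
    (hφ : ∀ δ > 0, ∀ᶠ i in l, ∀ j, j + 1 < N i → |φ i j - g ((j : ℝ) / N i)| ≤ δ) :
    Tendsto (fun i => 1 / (N i : ℝ) * ∑ k ∈ Finset.range (K i),
      (2 * ∑ p ∈ Finset.Ico (schedule α (N i) (K i) k) (schedule α (N i) (K i) (k + 1)),
          ∑ j ∈ Finset.Ico (schedule α (N i) (K i) k) p, φ i j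
        - g (α ((k : ℝ) / K i))
          * (((schedule α (N i) (K i) (k + 1) : ℝ) - schedule α (N i) (K i) k)
            * (schedule α (N i) (K i) (k + 1) - schedule α (N i) (K i) k - 1)))) l (𝓝 0) := by
  obtain ⟨C, hC0, hC⟩ := exists_bound_schedule_sub hα hmono h0 h1 hNK
  -- Each entry is off by at most 2δ, n(n-1) ≤ nC, and the step lengths n sum to N.
  refine tendsto_zero_of_forall_eventually_le_mul (2 * C) fun δ hδ => ?_
  filter_upwards [eventually_abs_sub_schedule_le hα hmono h0 h1 hg hN hK hNK hδ, hφ δ hδ, hC,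
    hN.eventually_gt_atTop 0, hK.eventually_gt_atTop 0] with i hosc hφi hCi hNi hKi
  have hN0 : (0 : ℝ) < N i := by exact_mod_cast hNi
  set a := schedule α (N i) (K i) with ha
  rw [abs_mul, abs_of_pos (by positivity : 0 < 1 / (N i : ℝ)), one_div_mul_eq_div,
    div_le_iff₀ hN0, ← sum_schedule_sub h0 h1 (N i) hKi, Finset.mul_sum]
  refine (Finset.abs_sum_le_sum_abs _ _).trans (Finset.sum_le_sum fun k hk => ?_)
  rw [Finset.mem_range] at hk
  have hstep : a k ≤ a (k + 1) := schedule_mono hmono _ (Nat.le_succ k) hk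
  have hle : a (k + 1) ≤ N i :=
    (schedule_mono hmono _ (show k + 1 ≤ K i from hk) le_rfl).trans (schedule_last h1 _ hKi).le
  refine (abs_two_mul_sum_sum_sub_le hstep (δ := 2 * δ) fun j hj1 hj2 => ?_).trans ?_
  · have h2 := hosc k hk j hj1 (by omega)
    have h3 := hφi j (by omega)
    have := abs_sub_le (φ i j) (g ((j : ℝ) / N i)) (g (α ((k : ℝ) / K i)))
    linarith
  · have hαk := mem_Icc_of_monotoneOn hmono h0 h1 (div_mem_Icc_zero_one hk.le)
    have hθ := (roundingError_mem_Ico (N := N i) hαk.1).1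
    rw [roundingError] at hθ
    have hn0 : (0 : ℝ) ≤ (a (k + 1) : ℝ) - a k := sub_nonneg.2 (by exact_mod_cast hstep)
    have hn1 : (a (k + 1) : ℝ) - a k - 1 ≤ C := by linarith [hCi k hk]
    calc _ ≤ 2 * δ * (((a (k + 1) : ℝ) - a k) * C) := by gcongr
      _ = _ := by ring

theorem tendsto_triangular_sum (hα : ContDiffOn ℝ 1 α (Icc 0 1))
    (hmono : MonotoneOn α (Icc 0 1)) (h0 : α 0 = 0) (h1 : α 1 = 1)
    (hpm : IsPiecewiseMonotone (derivWithin α (Icc 0 1))) (hg : ContinuousOn g (Icc 0 1))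
    (hs : 0 < s) (hN : Tendsto N l atTop) (hK : Tendsto K l atTop)
    (hNK : Tendsto (fun i => (N i : ℝ) / K i) l (𝓝 s)) {φ : ι → ℕ → ℝ}
    (hφ : ∀ δ > 0, ∀ᶠ i in l, ∀ j, j + 1 < N i → |φ i j - g ((j : ℝ) / N i)| ≤ δ)
    (hsum : ∀ᶠ i in l, ∑ j ∈ Finset.range (N i - 1), φ i j = N i) :
    Tendsto (fun i => 2 / (N i : ℝ) * ∑ k ∈ Finset.range (K i),
      ∑ p ∈ Finset.Ico (schedule α (N i) (K i) k) (schedule α (N i) (K i) (k + 1)),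
        ∑ j ∈ Finset.Ico (schedule α (N i) (K i) k) p, φ i j) l
      (𝓝 (s * (∫ t in (0 : ℝ)..1, g (α t) * quantSq s (derivWithin α (Icc 0 1) t)) - 1)) := by
  have hG : ContinuousOn (fun t => g (α t)) (Icc 0 1) :=
    hg.comp hα.continuousOn fun t ht => mem_Icc_of_monotoneOn hmono h0 h1 ht
  have hA := tendsto_triangular_sum_sub hα hmono h0 h1 hg hN hK hNK hφ
  have hB := tendsto_weighted_schedule_sum hα hmono h0 h1 hg hN hK hNK hφ hsum
  have hC := tendsto_weighted_rounding_sum hα hmono h0 h1 hpm hG hs hN hK hNK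
  have hD := tendsto_weighted_interpSq_sum hα hmono hG hs hK hNK
  -- This is the splitting n(n-1) = (n² - `interpSq` x) + `interpSq` x - n, plus the error of
  -- freezing g.
  have h := ((hA.add hC).add hD).sub hB
  rw [zero_add, zero_add] at h
  refine h.congr fun i => ?_
  rw [← mul_add, ← mul_add, ← mul_sub, ← Finset.sum_add_distrib, ← Finset.sum_add_distrib,
    ← Finset.sum_sub_distrib, Finset.mul_sum, Finset.mul_sum]
  refine Finset.sum_congr rfl fun k _ => ?_
  ring

end Profile

end MaskedDiffusion

theorem mainTheorem3 {X : Type*} [Fintype X]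
    -- the target distributions on sequences of length `N` over the finite alphabet `X`
    (π : ∀ N : ℕ, PMF (Fin N → X))
    -- the curve defining the schedule, of class `C¹` on `[0,1]`
    (α : ℝ → ℝ) (hα_mono : MonotoneOn α (Icc 0 1)) (hα_zero : α 0 = 0) (hα_one : α 1 = 1)
    (hα_smooth : ContDiffOn ℝ 1 α (Icc 0 1))
    -- uniform convergence of the rescaled profiles, each on its domain `[0, 1 - 1/N)`
    (g : ℝ → ℝ) (hg_cont : ContinuousOn g (Icc 0 1)) (hg_nonneg : ∀ u ∈ Icc (0 : ℝ) 1, 0 ≤ g u)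
    (hg_lim : ∀ ε > 0, ∀ᶠ N : ℕ in atTop, ∀ u ∈ Ico (0 : ℝ) (1 - 1 / (N : ℝ)),
      |MaskedDiffusion.rescaledProfile (π N) u - g u| < ε)
    -- finitely many minimum and maximum points of the derivative
    (hα_extr : MaskedDiffusion.IsPiecewiseMonotone (derivWithin α (Icc 0 1)))
    -- `N, K → ∞` with `N / K → s`
    (s : ℝ) (hs : 1 ≤ s) (N K : ℕ → ℕ) (hN : Tendsto N atTop atTop) (hK : Tendsto K atTop atTop)
    (hNK : Tendsto (fun m => (N m : ℝ) / (K m : ℝ)) atTop (𝓝 s)) :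
    ∃ ε : ℕ → ℝ, Tendsto ε atTop (𝓝 0) ∧ ∀ᶠ m in atTop,
      MaskedDiffusion.factError (π (N m)) (K m) (MaskedDiffusion.schedule α (N m) (K m))
        = MaskedDiffusion.corr (π (N m)) / 2 *
          (s * (∫ t in (0 : ℝ)..1,
              g (α t) * MaskedDiffusion.quantSq s (derivWithin α (Icc 0 1) t)) - 1 + ε m) := by
  open MaskedDiffusion in
  set I := s * (∫ t in (0 : ℝ)..1, g (α t) * quantSq s (derivWithin α (Icc 0 1) t)) - 1 with hI
  classical
  have hpos : ∀ᶠ m in atTop, 0 < N m ∧ 0 < K m :=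
    (hN.eventually_gt_atTop 0).and (hK.eventually_gt_atTop 0)
  have hstep : ∀ m, ∀ k < K m, schedule α (N m) (K m) k ≤ schedule α (N m) (K m) (k + 1) :=
    fun m k hk => schedule_mono hα_mono _ (Nat.le_succ k) hk
  -- Where D ≠ 0 the identity forces ε; where D = 0 any value works.
  refine ⟨fun m => if corr (π (N m)) = 0 then 0 else
    2 / corr (π (N m)) * factError (π (N m)) (K m) (schedule α (N m) (K m)) - I, ?_, ?_⟩
  · refine Tendsto.if tendsto_const_nhds ?_
    -- D may vanish infinitely often, so the limits are taken along the indices with D ≠ 0; the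
    -- preceding results hold for an arbitrary filter.
    set l : Filter ℕ := atTop ⊓ 𝓟 {m | ¬ corr (π (N m)) = 0}
    have hl : l ≤ atTop := inf_le_left
    have hD : ∀ᶠ m in l, corr (π (N m)) ≠ 0 := mem_inf_of_right (mem_principal_self _)
    have hφ : ∀ δ > 0, ∀ᶠ m in l, ∀ j, j + 1 < N m →
        |(N m : ℝ) / corr (π (N m)) * deltaProfile (π (N m)) (j + 1) - g ((j : ℝ) / N m)|
          ≤ δ := by
      intro δ hδ
      filter_upwards [hl (hN.eventually (hg_lim δ hδ))] with m hm j hj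
      have hN0 : (0 : ℝ) < N m := by exact_mod_cast (Nat.zero_lt_succ j).trans hj
      have hu : (j : ℝ) / N m ∈ Ico (0 : ℝ) (1 - 1 / (N m : ℝ)) := by
        refine ⟨by positivity, ?_⟩
        have hj' : (j : ℝ) + 1 < N m := by exact_mod_cast hj
        rw [one_sub_div hN0.ne']
        gcongr
        linarith
      rw [← rescaledProfile_div _ (by omega)]
      exact (hm _ hu).le
    have hsum : ∀ᶠ m in l, ∑ j ∈ Finset.range (N m - 1),
        (N m : ℝ) / corr (π (N m)) * deltaProfile (π (N m)) (j + 1) = N m := by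
      filter_upwards [hD, hl hpos] with m hm hp
      rw [← Finset.mul_sum, sum_deltaProfile _ hp.1]
      field_simp
    have h := tendsto_triangular_sum hα_smooth hα_mono hα_zero hα_one hα_extr hg_cont
      (by linarith) (hN.mono_left hl) (hK.mono_left hl) (hNK.mono_left hl) hφ hsum
    rw [← hI, ← tendsto_sub_nhds_zero_iff] at h
    refine h.congr' ?_
    filter_upwards [hD, hl hpos] with m hm hp
    have hN0 : (N m : ℝ) ≠ 0 := by have := hp.1; positivity
    rw [factError_eq_sum _ (schedule_zero hα_zero _ _) (hstep m) (schedule_last hα_one _ hp.2)]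
    simp only [← Finset.mul_sum]
    rw [← mul_assoc]
    congr 2
    field_simp
  · filter_upwards [hpos] with m hp
    by_cases hm : corr (π (N m)) = 0
    · rw [factError_eq_zero_of_corr_eq_zero _ hm (schedule_zero hα_zero _ _) (hstep m)
        (schedule_last hα_one _ hp.2), hm]
      ring
    · rw [if_neg hm]
      field_simp
      ring
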